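/- Let $1\le k\le n-1$ and let $B\subset\mathbb{R}^n$ be a nonempty polytope with vertices in $\mathbb{Z}^n$ that is not a segment. For $X\subset\mathbb{R}^n$ let $\mathbb{C}^X$ be the space of Laurent polynomials in $\mathbb{C}[x_1^{\pm1},\dots,x_n^{\pm1}]$ whose exponents all lie in $X\cap\mathbb{Z}^n$ (they are said to be supported in $X$), and let $f|_X$ denote the sum of the terms of $f$ with exponents in $X$. Call a tuple $f=(f_1,\dots,f_k)$ of Laurent polynomials \emph{generic} (for $B$) if 1. $f_1,\dots,f_k$ is a regular sequence in $\mathbb{C}[x_1^{\pm1},\dots,x_n^{\pm1}]$, that is, each $f_i$ is a non-zero-divisor modulo $(f_1,\dots,f_{i-1})$, and $(f_1,\dots,f_k)\ne(1)$; 2. for every face $F$ of $B$, each $f_i|_F$ is a non-zero-divisor modulo $(f_1|_F,\dots,f_{i-1}|_F)$ (here the quotient by all of the $f_i|_F$ may be zero); 3. the Newton polytope of every $f_i$ is $B$. If $k\le\dim B$, then the generic tuples contain a nonempty Zariski open subset of $(\mathbb{C}^B)^k$. Moreover, for every generic tuple $f=(f_1,\dots,f_k)$: * For every $A\subset\mathbb{R}^n$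 (for instance a polytope) and every real $t\ge0$ with $A\subset(t+1)B$, the $k$ copies of $tB$ form a foundation for $(A,B,\dots,B)$: the space $\mathcal V_A^f=(f_1,\dots,f_k)\cap\mathbb{C}^A$ equals the space of all $g\in\mathbb{C}^A$ of the form $g=s_1f_1+\dots+s_kf_k$ with every $s_i\in\mathbb{C}^{tB}$. In other words, every $g\in(f_1,\dots,f_k)$ supported in $A$ can be written $g=\sum_i s_if_i$ with every $s_i$ supported in $tB$. * In particular $\dim_{\mathbb{C}}\bigl((f_1,\dots,f_k)\cap\mathbb{C}^B\bigr)=k$ (the case $A=B$, $t=0$; that is, $\dim\mathcal V_A^A=k$ for the tuple $(A,A,\dots,A)$). -/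

import Mathlib

open scoped Pointwise

noncomputable section

namespace EffMember

/-- The ring `ℂ[x₁^{±1}, …, xₙ^{±1}]` of Laurent polynomials in `n` variables. -/
abbrev Laurent (n : ℕ) : Type := AddMonoidAlgebra ℂ (Fin n → ℤ)

/-- The inclusion `ℤⁿ ⊂ ℝⁿ`. -/
def toReal {n : ℕ} (m : Fin n → ℤ) : Fin n → ℝ := fun i => (m i : ℝ)

/-- The set of lattice points of `X ⊆ ℝⁿ`. -/
def latticePts {n : ℕ} (X : Set (Fin n → ℝ)) : Set (Fin n → ℤ) := {m | toReal m ∈ X}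

/-- The space `ℂ^X` of Laurent polynomials all of whose exponents lie in `X ⊆ ℝⁿ`. -/
def suppIn {n : ℕ} (X : Set (Fin n → ℝ)) : Submodule ℂ (Laurent n) :=
  AddMonoidAlgebra.supported ℂ ℂ (latticePts X)

/-- A (nonempty) polytope with vertices in `ℤⁿ`. -/
def IsLatticePolytope {n : ℕ} (B : Set (Fin n → ℝ)) : Prop :=
  ∃ S : Finset (Fin n → ℤ), S.Nonempty ∧ B = convexHull ℝ (toReal '' (S : Set (Fin n → ℤ)))

/-- A segment with two distinct end points. -/
def IsSegment {n : ℕ} (B : Set (Fin n → ℝ)) : Prop :=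
  ∃ p q : Fin n → ℝ, p ≠ q ∧ B = segment ℝ p q

/-- The dimension of (the affine hull of) a nonempty set in `ℝⁿ`. -/
def polyDim {n : ℕ} (B : Set (Fin n → ℝ)) : ℕ := Module.finrank ℝ (vectorSpan ℝ B)

/-- The Newton polytope of a Laurent polynomial. -/
def newtonPolytope {n : ℕ} (f : Laurent n) : Set (Fin n → ℝ) :=
  convexHull ℝ (toReal '' (f.coeff.support : Set (Fin n → ℤ)))

/-- The face `B(v)` of `B` on which the linear form `v` is minimal (`B(0) = B`). -/
def face {n : ℕ} (B : Set (Fin n → ℝ)) (v : Fin n → ℝ) : Set (Fin n → ℝ) :=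
  {a | a ∈ B ∧ ∀ x ∈ B, v ⬝ᵥ a ≤ v ⬝ᵥ x}

open Classical in
/-- The restriction `f|_X`: the sum of the terms of `f` whose exponents lie in `X`. -/
def restrict {n : ℕ} (f : Laurent n) (X : Set (Fin n → ℝ)) : Laurent n :=
  AddMonoidAlgebra.ofCoeff (f.coeff.filter (fun m => toReal m ∈ X))

/-- Generic tuples of Laurent polynomials supported in a polytope `B`. -/
structure IsGeneric {n k : ℕ} (B : Set (Fin n → ℝ)) (f : Fin k → Laurent n) : Prop where
  /-- the Newton polytope of each `fᵢ` is `B` -/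
  newton : ∀ i, newtonPolytope (f i) = B
  /-- `f₁, …, f_k` is a regular sequence in the Laurent polynomial ring -/
  regular : RingTheory.Sequence.IsRegular (Laurent n) (List.ofFn f)
  /-- on every face the restrictions form a regular sequence, where the quotient by all of them
  may vanish (as it has to if the dimension of the face is less than `k`) -/
  regular_face : ∀ v : Fin n → ℝ,
    RingTheory.Sequence.IsWeaklyRegular (Laurent n)
      (List.ofFn fun i => restrict (f i) (face B v))

/-- `V_A^f`: the members of the ideal `(f₁, …, f_k)` that are supported in `A`. -/
def V {n k : ℕ} (f : Fin k → Laurent n) (A : Set (Fin n → ℝ)) : Submodule ℂ (Laurent n) :=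
  (Ideal.span (Set.range f)).restrictScalars ℂ ⊓ suppIn A

/-- `V_A^{C,f}`: the Laurent polynomials supported in `A` that can be written as
`c₁ f₁ + ⋯ + c_k f_k` with each `cᵢ` supported in `Cᵢ`. -/
def VC {n k : ℕ} (f : Fin k → Laurent n) (C : Fin k → Set (Fin n → ℝ))
    (A : Set (Fin n → ℝ)) : Submodule ℂ (Laurent n) where
  carrier := {g | (∃ c : Fin k → Laurent n, (∀ i, c i ∈ suppIn (C i)) ∧ g = ∑ i, c i * f i) ∧
    g ∈ suppIn A}
  zero_mem' := ⟨⟨0, fun _ => Submodule.zero_mem _, by simp⟩, Submodule.zero_mem _⟩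
  add_mem' := by
    rintro _ _ ⟨⟨c, hc, rfl⟩, hA⟩ ⟨⟨d, hd, rfl⟩, hA'⟩
    exact ⟨⟨c + d, fun i => Submodule.add_mem _ (hc i) (hd i), by
      simp [add_mul, Finset.sum_add_distrib]⟩, Submodule.add_mem _ hA hA'⟩
  smul_mem' := by
    rintro a _ ⟨⟨c, hc, rfl⟩, hA⟩
    exact ⟨⟨a • c, fun i => Submodule.smul_mem _ a (hc i), by
      simp [Finset.smul_sum]⟩, Submodule.smul_mem _ a hA⟩

/-- `C = (C₁, …, C_k)` is a foundation for `A` and `f`. -/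
def IsFoundation {n k : ℕ} (f : Fin k → Laurent n) (A : Set (Fin n → ℝ))
    (C : Fin k → Set (Fin n → ℝ)) : Prop :=
  VC f C A = V f A

/-- The property `Q` holds on a nonempty Zariski open subset of `(ℂ^B)^k`, namely wherever some
nonzero polynomial in the coefficients of `f₁, …, f_k` does not vanish. -/
def ZariskiGenerically {n : ℕ} (k : ℕ) (B : Set (Fin n → ℝ))
    (Q : (Fin k → Laurent n) → Prop) : Prop :=
  ∃ P : MvPolynomial (Fin k × latticePts B) ℂ, P ≠ 0 ∧
    ∀ f : Fin k → Laurent n, (∀ i, f i ∈ suppIn B) →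
      MvPolynomial.eval (fun p => (f p.1).coeff (p.2 : Fin n → ℤ)) P ≠ 0 → Q f

end EffMember

end

/-! Lift `ℤⁿ` to height zero in `ℝⁿ × ℝ` and each lattice point `b` of `B` to the generator `(b,
1)`. The slice at height `t` of the cone over these generators is `t • B`. Multiplication by a
polynomial supported in `B` raises the height by one, so the theorem asks for coefficients at height
`t` when `g` lies at height `t + 1`. `Effective` is this assertion on a face of the cone, with an
arbitrary shift.

To prove it, take any representation of `g` by `j` polynomials and a generic direction `a` in the
relative interior of the cone. The level of an exponent is the least nonnegative multiple of `a`
that moves it into the cone. If the highest level `ρ` is positive, genericity puts all exponents of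
level `ρ` on one translate of a hyperplane cutting out a face `F`, and forces `F` to have rank at
least `j`. The product terms there have no counterpart in `g`, so the top parts of the coefficients
form a relation between the restrictions to `F`. These are weakly regular, and membership for fewer
than `j` of them on `F` is known by induction; hence the relation is a Koszul relation with
controlled supports (`exists_antisymm_of_relation`). Subtracting the same Koszul combination of the
full polynomials preserves `g` and lowers the level (`exists_lower_level`). Only finitely many
levels occur, and level zero means that the supports are as required (`effective_step`,
`effective_of_regular_faces`).

The rank needed is supplied by `k ≤ dim B`. A generic tuple satisfies this automatically: a regular
sequence is algebraically independent, and after a translation its exponents lie in the direction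
space of `B` (`IsGeneric.le_polyDim`). For `t = 0` the coefficients are constants, which gives the
dimension of `V f B`.

For the open set, the tuple with indeterminate coefficients is weakly regular by a linear change of
variables (`wReg_univFamily`), and generic flatness transfers this to almost all specializations
(`exists_wReg_specialization`). The ideal is proper because writing `1`, at height zero, would need
coefficients at height `-1`, where the cone is empty (`one_notMem_span`). -/

noncomputable section

namespace EffMember

/-! ### Finitely generated convex cones -/

section Cone

variable {G E : Type*} [AddCommGroup E] [Module ℝ E]

/-- The convex cone generated by the vectors `h b`, `b ∈ W`. -/
def coneOf (h : G → E) (W : Finset G) : Set E :=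
  {x | ∃ c : G → ℝ, (∀ b, 0 ≤ c b) ∧ x = ∑ b ∈ W, c b • h b}

variable {h : G → E} {W : Finset G}

lemma add_mem_coneOf {x y : E} (hx : x ∈ coneOf h W) (hy : y ∈ coneOf h W) :
    x + y ∈ coneOf h W := by
  obtain ⟨c, hc, rfl⟩ := hx
  obtain ⟨d, hd, rfl⟩ := hy
  exact ⟨c + d, fun b => add_nonneg (hc b) (hd b), by
    simp [add_smul, Finset.sum_add_distrib]⟩

lemma smul_mem_coneOf {x : E} (hx : x ∈ coneOf h W) {t : ℝ} (ht : 0 ≤ t) :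
    t • x ∈ coneOf h W := by
  obtain ⟨c, hc, rfl⟩ := hx
  exact ⟨t • c, fun b => mul_nonneg ht (hc b), by simp [Finset.smul_sum, smul_smul]⟩

lemma gen_mem_coneOf {b : G} (hb : b ∈ W) : h b ∈ coneOf h W := by
  classical
  exact ⟨Pi.single b 1, fun b' => by by_cases hbb : b' = b <;> simp [hbb], by
    simp [Pi.single_apply, Finset.sum_ite_eq', hb]⟩

lemma coneOf_mono {W' : Finset G} (hW : W' ⊆ W) : coneOf h W' ⊆ coneOf h W := by
  classical
  rintro _ ⟨c, hc, rfl⟩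
  refine ⟨fun b => if b ∈ W' then c b else 0, fun b => by dsimp only; split_ifs <;> simp [hc], ?_⟩
  rw [← Finset.sum_subset hW]
  · exact Finset.sum_congr rfl fun b hb => by simp [hb]
  · intro b _ hb
    simp [hb]

lemma mem_span_of_mem_coneOf {x : E} (hx : x ∈ coneOf h W) :
    x ∈ Submodule.span ℝ (h '' W) := by
  obtain ⟨c, -, rfl⟩ := hx
  exact Submodule.sum_mem _ fun b hb =>
    Submodule.smul_mem _ _ (Submodule.subset_span ⟨b, hb, rfl⟩)

lemma nonneg_of_mem_coneOf {x : E} (hx : x ∈ coneOf h W) (v : E →ₗ[ℝ] ℝ)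
    (hv : ∀ b ∈ W, 0 ≤ v (h b)) : 0 ≤ v x := by
  obtain ⟨c, hc, rfl⟩ := hx
  rw [map_sum]
  exact Finset.sum_nonneg fun b hb => by
    rw [map_smul]; exact mul_nonneg (hc b) (hv b hb)

lemma mem_coneOf_face {x : E} (hx : x ∈ coneOf h W) (v : E →ₗ[ℝ] ℝ)
    (hv : ∀ b ∈ W, 0 ≤ v (h b)) (hvx : v x = 0) :
    x ∈ coneOf h (W.filter fun b => v (h b) = 0) := by
  obtain ⟨c, hc, rfl⟩ := hx
  refine ⟨c, hc, ?_⟩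
  rw [map_sum, Finset.sum_eq_zero_iff_of_nonneg (fun b hb => by
    rw [map_smul]; exact mul_nonneg (hc b) (hv b hb))] at hvx
  rw [Finset.sum_filter]
  refine Finset.sum_congr rfl fun b hb => ?_
  have := hvx b hb
  rw [map_smul, smul_eq_mul, mul_eq_zero] at this
  rcases this with h0 | h0
  · simp [h0]
  · simp [h0]

lemma mem_coneOf_insert [DecidableEq G] {b : G} (hb : b ∉ W) {x : E} :
    x ∈ coneOf h (insert b W) ↔ ∃ t : ℝ, 0 ≤ t ∧ x - t • h b ∈ coneOf h W := by
  constructor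
  · rintro ⟨c, hc, rfl⟩
    exact ⟨c b, hc b, c, hc, by rw [Finset.sum_insert hb]; simp⟩
  · rintro ⟨t, ht, hx⟩
    have := add_mem_coneOf (coneOf_mono (Finset.subset_insert b W) hx)
      (smul_mem_coneOf (gen_mem_coneOf (h := h) (Finset.mem_insert_self b W)) ht)
    simpa using this

/-- **Minkowski–Weyl**: a finitely generated cone is cut out by finitely many linear
inequalities. -/
theorem exists_dual_coneOf [FiniteDimensional ℝ E] (h : G → E) (W : Finset G) :
    ∃ I : Finset (E →ₗ[ℝ] ℝ), ∀ x, x ∈ coneOf h W ↔ ∀ v ∈ I, 0 ≤ v x := by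
  classical
  induction W using Finset.induction_on with
  | empty =>
    let B := Module.finBasis ℝ E
    refine ⟨Finset.univ.image (fun i => B.coord i) ∪ Finset.univ.image (fun i => -B.coord i),
      fun x => ⟨?_, fun hx => ?_⟩⟩
    · rintro ⟨c, -, rfl⟩
      simp
    · refine ⟨0, by simp, ?_⟩
      simp only [Finset.sum_empty]
      refine (B.ext_elem_iff).2 fun i => ?_
      have h1 := hx (B.coord i) (by simp)
      have h2 := hx (-B.coord i) (by simp)
      simp only [LinearMap.neg_apply, Module.Basis.coord_apply] at h1 h2
      simp
      linarith
  | insert b W hb ih =>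
    obtain ⟨I, hI⟩ := ih
    set w := h b
    -- Fourier–Motzkin elimination of `t` from the conditions `t * v w ≤ v x`: each pair with `v w`
    -- of opposite signs gives one combined inequality.
    refine ⟨I.filter (fun v => 0 ≤ v w) ∪
      Finset.image₂ (fun v v' => v w • v' - v' w • v) (I.filter fun v => 0 < v w)
        (I.filter fun v => v w < 0), fun x => ?_⟩
    rw [mem_coneOf_insert hb]
    constructor
    · rintro ⟨t, ht, hx⟩ v hv
      rw [hI] at hx
      simp only [map_sub, map_smul, smul_eq_mul] at hx
      rcases Finset.mem_union.1 hv with hv | hv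
      · rw [Finset.mem_filter] at hv
        nlinarith [hx v hv.1, mul_nonneg ht hv.2]
      · obtain ⟨p, hp, q, hq, rfl⟩ := Finset.mem_image₂.1 hv
        rw [Finset.mem_filter] at hp hq
        have h1 := mul_nonneg hp.2.le (hx q hq.1)
        have h2 := mul_nonneg (neg_nonneg.2 hq.2.le) (hx p hp.1)
        simp only [LinearMap.sub_apply, LinearMap.smul_apply, smul_eq_mul]
        nlinarith
    · intro hx
      -- The functionals negative at `w` bound `t` from below; the largest of these bounds and `0`
      -- is the witness.
      let Z : Finset ℝ := insert 0 ((I.filter fun v => v w < 0).image fun v => v x / v w)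
      have hZ : Z.Nonempty := Finset.insert_nonempty _ _
      refine ⟨Z.max' hZ, Z.le_max' 0 (Finset.mem_insert_self _ _), (hI _).2 fun v hv => ?_⟩
      simp only [map_sub, map_smul, smul_eq_mul]
      rcases lt_trichotomy (v w) 0 with hvw | hvw | hvw
      · have := Z.le_max' (v x / v w) (Finset.mem_insert_of_mem
          (Finset.mem_image_of_mem _ (Finset.mem_filter.2 ⟨hv, hvw⟩)))
        rw [div_le_iff_of_neg hvw] at this
        linarith
      · have := hx v (Finset.mem_union_left _ (Finset.mem_filter.2 ⟨hv, hvw.ge⟩))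
        rw [hvw]; linarith
      · have hmem := Z.max'_mem hZ
        rcases Finset.mem_insert.1 hmem with h0 | h0
        · have := hx v (Finset.mem_union_left _ (Finset.mem_filter.2 ⟨hv, hvw.le⟩))
          rw [h0]; linarith
        · obtain ⟨q, hq, hqe⟩ := Finset.mem_image.1 h0
          have hq' := Finset.mem_filter.1 hq
          have := hx _ (Finset.mem_union_right _ (Finset.mem_image₂_of_mem
            (Finset.mem_filter.2 ⟨hv, hvw⟩) hq))
          simp only [LinearMap.sub_apply, LinearMap.smul_apply, smul_eq_mul] at this
          rw [← hqe, sub_nonneg, div_mul_eq_mul_div, div_le_iff_of_neg hq'.2]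
          linarith

/-- A positive combination of the generators of a cone avoids countably many given subspaces that
do not contain the cone. -/
theorem exists_generic_point {ι : Type*} [Countable ι] [FiniteDimensional ℝ E] (h : G → E)
    (W : Finset G) (N : ι → Submodule ℝ E) (hN : ∀ i, ¬ Submodule.span ℝ (h '' W) ≤ N i) :
    ∃ c : G → ℝ, (∀ b ∈ W, 0 < c b) ∧ ∀ i, ∑ b ∈ W, c b • h b ∉ N i := by
  classical
  -- In coefficient space the preimages are proper subspaces, hence Lebesgue null, and countably
  -- many of them cannot cover the open positive orthant.
  let T : (W → ℝ) →ₗ[ℝ] E := Fintype.linearCombination ℝ (fun b : W => h b)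
  have hT : ∀ i, MeasureTheory.volume (((N i).comap T : Submodule ℝ (W → ℝ)) : Set (W → ℝ)) = 0 := by
    intro i
    refine MeasureTheory.Measure.addHaar_submodule _ _ fun htop => hN i ?_
    rw [Submodule.span_le]
    rintro _ ⟨b, hb, rfl⟩
    have : (Pi.single ⟨b, hb⟩ 1 : W → ℝ) ∈ (N i).comap T := htop ▸ Submodule.mem_top
    simpa [T, Fintype.linearCombination_apply, Pi.single_apply] using this
  have hU : MeasureTheory.volume (⋃ i, (((N i).comap T : Submodule ℝ (W → ℝ)) : Set (W → ℝ))) = 0 :=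
    MeasureTheory.measure_iUnion_null hT
  have hO : IsOpen (Set.pi Set.univ fun _ : W => Set.Ioi (0 : ℝ)) :=
    isOpen_set_pi Set.finite_univ fun _ _ => isOpen_Ioi
  have hpos : 0 < MeasureTheory.volume (Set.pi Set.univ fun _ : W => Set.Ioi (0 : ℝ)) :=
    hO.measure_pos _ ⟨fun _ => 1, by simp⟩
  obtain ⟨c, hc, hcU⟩ : ∃ c ∈ (Set.pi Set.univ fun _ : W => Set.Ioi (0 : ℝ)),
      c ∉ (⋃ i, (((N i).comap T : Submodule ℝ (W → ℝ)) : Set (W → ℝ))) := by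
    by_contra! hcon
    exact hpos.ne' (MeasureTheory.measure_mono_null hcon hU)
  refine ⟨fun b => if hb : b ∈ W then c ⟨b, hb⟩ else 0, fun b hb => ?_, fun i hi => hcU ?_⟩
  · simpa [hb] using hc ⟨b, hb⟩ (Set.mem_univ _)
  · refine Set.mem_iUnion.2 ⟨i, ?_⟩
    have : T c = ∑ b ∈ W, (if hb : b ∈ W then c ⟨b, hb⟩ else 0) • h b := by
      rw [← Finset.sum_coe_sort W]
      simp [T, Fintype.linearCombination_apply]
    simpa [this] using hi

/-- The gauge of a cone in the direction of a point `a` of its relative interior. -/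
theorem exists_gauge {I : Finset (E →ₗ[ℝ] ℝ)} (hI : ∀ x, x ∈ coneOf h W ↔ ∀ v ∈ I, 0 ≤ v x)
    {c : G → ℝ} (hc : ∀ b ∈ W, 0 < c b) {a : E} (ha : a = ∑ b ∈ W, c b • h b) {x : E}
    (hx : x ∈ Submodule.span ℝ (h '' W)) :
    ∃ r : ℝ, 0 ≤ r ∧ (∀ ρ : ℝ, 0 ≤ ρ → (x + ρ • a ∈ coneOf h W ↔ r ≤ ρ)) ∧
      (0 < r → ∃ v ∈ I, 0 < v a ∧ v x = - (r * v a)) := by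
  classical
  have hgen : ∀ v ∈ I, ∀ b ∈ W, 0 ≤ v (h b) := fun v hv b hb => (hI _).1 (gen_mem_coneOf hb) v hv
  -- Since `a` has positive weight on every generator, a functional of `I` that is not positive at
  -- `a` kills all generators; it puts no condition on `ρ`.
  have hva : ∀ v ∈ I, ∀ y ∈ Submodule.span ℝ (h '' W), ¬ 0 < v a → v y = 0 := by
    intro v hv y hy hv0
    have hs : v a = ∑ b ∈ W, c b * v (h b) := by simp [ha]
    have h0 : ∑ b ∈ W, c b * v (h b) = 0 :=
      le_antisymm (hs ▸ not_lt.1 hv0)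
        (Finset.sum_nonneg fun b hb => mul_nonneg (hc b hb).le (hgen v hv b hb))
    rw [Finset.sum_eq_zero_iff_of_nonneg
      fun b hb => mul_nonneg (hc b hb).le (hgen v hv b hb)] at h0
    have : Submodule.span ℝ (h '' W) ≤ LinearMap.ker v := by
      rw [Submodule.span_le]
      rintro _ ⟨b, hb, rfl⟩
      exact (mul_eq_zero.1 (h0 b hb)).resolve_left (hc b hb).ne'
    exact this hy
  let Z : Finset ℝ := insert 0 ((I.filter fun v => 0 < v a).image fun v => - v x / v a)
  have hZ : Z.Nonempty := Finset.insert_nonempty _ _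
  refine ⟨Z.max' hZ, Z.le_max' 0 (Finset.mem_insert_self _ _), fun ρ hρ => ?_, fun hr => ?_⟩
  · rw [hI]
    simp only [map_add, map_smul, smul_eq_mul]
    constructor
    · intro hv
      refine Finset.max'_le _ _ _ fun y hy => ?_
      rcases Finset.mem_insert.1 hy with rfl | hy
      · exact hρ
      · obtain ⟨v, hv', rfl⟩ := Finset.mem_image.1 hy
        rw [Finset.mem_filter] at hv'
        rw [div_le_iff₀ hv'.2]
        linarith [hv v hv'.1]
    · intro hle v hv
      by_cases hv0 : 0 < v a
      · have := (Z.le_max' (- v x / v a) (Finset.mem_insert_of_mem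
          (Finset.mem_image_of_mem _ (Finset.mem_filter.2 ⟨hv, hv0⟩)))).trans hle
        rw [div_le_iff₀ hv0] at this
        linarith
      · have h1 := hva v hv x hx hv0
        have h2 := hva v hv a (mem_span_of_mem_coneOf (ha ▸ ⟨fun b => if b ∈ W then c b else 0,
          fun b => by dsimp only; split_ifs with hb <;> simp [(hc b · |>.le), *],
          Finset.sum_congr rfl fun b hb => by simp [hb]⟩)) hv0
        rw [h1, h2]; simp
  · rcases Finset.mem_insert.1 (Z.max'_mem hZ) with h0 | h0
    · exact absurd h0 hr.ne'
    · obtain ⟨v, hv, hve⟩ := Finset.mem_image.1 h0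
      rw [Finset.mem_filter] at hv
      refine ⟨v, hv.1, hv.2, ?_⟩
      rw [← hve]
      have := hv.2.ne'
      field_simp

end Cone

end EffMember

namespace EffMember

/-! ### Truncation and supports of elements of a group algebra -/

section Filter

variable {G : Type*}

open Classical in
/-- The sum of the terms of `s` whose exponents satisfy `p`. -/
def filt (p : G → Prop) (s : AddMonoidAlgebra ℂ G) : AddMonoidAlgebra ℂ G :=
  AddMonoidAlgebra.ofCoeff (s.coeff.filter p)

open Classical in
lemma coeff_filt (p : G → Prop) (s : AddMonoidAlgebra ℂ G) (m : G) :
    (filt p s).coeff m = if p m then s.coeff m else 0 := by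
  simp [filt, AddMonoidAlgebra.coeff_ofCoeff, Finsupp.filter_apply]

lemma coeff_filt_ne_zero {p : G → Prop} {s : AddMonoidAlgebra ℂ G} {m : G} :
    (filt p s).coeff m ≠ 0 ↔ s.coeff m ≠ 0 ∧ p m := by
  classical
  rw [coeff_filt]
  split_ifs with hp <;> simp [hp]

lemma laurent_ext {s t : AddMonoidAlgebra ℂ G} (h : ∀ m, s.coeff m = t.coeff m) : s = t := by
  ext m
  exact h m

lemma filt_filt {p q r : G → Prop} (h : ∀ m, p m ↔ q m ∧ r m) (s : AddMonoidAlgebra ℂ G) :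
    filt p s = filt r (filt q s) := by
  classical
  refine laurent_ext fun m => ?_
  simp only [coeff_filt]
  have := h m
  by_cases h1 : p m <;> by_cases h2 : q m <;> by_cases h3 : r m <;> simp_all

lemma filt_add (p : G → Prop) (s t : AddMonoidAlgebra ℂ G) :
    filt p (s + t) = filt p s + filt p t := by
  classical
  refine laurent_ext fun m => ?_
  simp only [coeff_filt, AddMonoidAlgebra.coeff_add, Finsupp.add_apply]
  split_ifs <;> simp

lemma filt_zero (p : G → Prop) : filt p (0 : AddMonoidAlgebra ℂ G) = 0 := by
  classical
  refine laurent_ext fun m => ?_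
  simp [coeff_filt]

lemma filt_sum (p : G → Prop) {ι : Type*} (T : Finset ι) (s : ι → AddMonoidAlgebra ℂ G) :
    filt p (∑ i ∈ T, s i) = ∑ i ∈ T, filt p (s i) := by
  classical
  induction T using Finset.induction_on with
  | empty => simp [filt_zero]
  | insert a T ha ih => rw [Finset.sum_insert ha, Finset.sum_insert ha, filt_add, ih]

lemma filt_add_filt_not (p : G → Prop) (s : AddMonoidAlgebra ℂ G) :
    filt p s + filt (fun m => ¬ p m) s = s := by
  classical
  refine laurent_ext fun m => ?_
  simp only [coeff_filt, AddMonoidAlgebra.coeff_add, Finsupp.add_apply]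
  split_ifs <;> simp

lemma filt_eq_self {p : G → Prop} {s : AddMonoidAlgebra ℂ G} (h : ∀ m, s.coeff m ≠ 0 → p m) :
    filt p s = s := by
  classical
  refine laurent_ext fun m => ?_
  rw [coeff_filt]
  split_ifs with hp
  · rfl
  · by_contra hne
    exact hp (h m (Ne.symm hne))

lemma filt_eq_zero {p : G → Prop} {s : AddMonoidAlgebra ℂ G} (h : ∀ m, s.coeff m ≠ 0 → ¬ p m) :
    filt p s = 0 := by
  classical
  refine laurent_ext fun m => ?_
  rw [coeff_filt]
  split_ifs with hp
  · by_contra hne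
    exact h m hne hp
  · rfl

/-- The space of the `s` supported in `X`. -/
abbrev suppOn (X : Set G) : Submodule ℂ (AddMonoidAlgebra ℂ G) :=
  AddMonoidAlgebra.supported ℂ ℂ X

lemma mem_suppOn {X : Set G} {s : AddMonoidAlgebra ℂ G} :
    s ∈ suppOn X ↔ ∀ m, s.coeff m ≠ 0 → m ∈ X := by
  rw [AddMonoidAlgebra.mem_supported']
  exact forall_congr' fun m => not_imp_comm

lemma filt_mem_suppOn {p : G → Prop} {s : AddMonoidAlgebra ℂ G} {X Y : Set G} (hs : s ∈ suppOn X)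
    (h : ∀ m ∈ X, p m → m ∈ Y) : filt p s ∈ suppOn Y := by
  classical
  rw [mem_suppOn] at hs ⊢
  intro m hm
  rw [coeff_filt] at hm
  split_ifs at hm with hp
  · exact h m (hs m hm) hp
  · exact absurd rfl hm

lemma filt_mem_suppOn_self (W : Finset G) (g : AddMonoidAlgebra ℂ G) :
    filt (· ∈ W) g ∈ suppOn (W : Set G) :=
  filt_mem_suppOn (X := Set.univ) (mem_suppOn.2 fun _ _ => Set.mem_univ _) fun _ _ hp => hp

variable [AddCommGroup G]

lemma exists_of_coeff_mul_ne_zero {s f : AddMonoidAlgebra ℂ G} {m : G}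
    (h : (s * f).coeff m ≠ 0) : ∃ a b, s.coeff a ≠ 0 ∧ f.coeff b ≠ 0 ∧ a + b = m := by
  classical
  have h1 := AddMonoidAlgebra.support_coeff_mul_subset s f (Finsupp.mem_support_iff.2 h)
  obtain ⟨a, ha, b, hb, hab⟩ := Finset.mem_add.1 h1
  exact ⟨a, b, Finsupp.mem_support_iff.1 ha, Finsupp.mem_support_iff.1 hb, hab⟩

lemma mul_mem_suppOn {s f : AddMonoidAlgebra ℂ G} {X Y Z : Set G} (hs : s ∈ suppOn X)
    (hf : f ∈ suppOn Y) (h : ∀ a ∈ X, ∀ b ∈ Y, a + b ∈ Z) : s * f ∈ suppOn Z := by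
  rw [mem_suppOn] at *
  intro m hm
  obtain ⟨a, b, ha, hb, rfl⟩ := exists_of_coeff_mul_ne_zero hm
  exact h a (hs a ha) b (hf b hb)

lemma filt_mul {p q : G → Prop} {s f : AddMonoidAlgebra ℂ G}
    (h : ∀ a, s.coeff a ≠ 0 → ∀ b, f.coeff b ≠ 0 → (p (a + b) ↔ q a)) :
    filt p (s * f) = filt q s * f := by
  classical
  conv_lhs => rw [← filt_add_filt_not q s]
  have h1 : filt p (filt q s * f) = filt q s * f := filt_eq_self fun m hm => by
    obtain ⟨a, b, ha, hb, rfl⟩ := exists_of_coeff_mul_ne_zero hm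
    rw [coeff_filt_ne_zero] at ha
    exact (h a ha.1 b hb).2 ha.2
  have h2 : filt p (filt (fun m => ¬ q m) s * f) = 0 := filt_eq_zero fun m hm hp => by
    obtain ⟨a, b, ha, hb, rfl⟩ := exists_of_coeff_mul_ne_zero hm
    rw [coeff_filt_ne_zero] at ha
    exact ha.2 ((h a ha.1 b hb).1 hp)
  rw [add_mul, filt_add, h1, h2, add_zero]

/-- The initial form of a product is the product of the initial forms. -/
lemma filt_mul_initial {φ ψ χ : G → ℝ} (hχ : ∀ a b, χ (a + b) = φ a + ψ b) {α : ℝ}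
    {s f : AddMonoidAlgebra ℂ G} (hs : ∀ a, s.coeff a ≠ 0 → α ≤ φ a)
    (hf : ∀ b, f.coeff b ≠ 0 → 0 ≤ ψ b) :
    filt (fun m => χ m = α) (s * f) = filt (fun m => φ m = α) s * filt (fun b => ψ b = 0) f := by
  classical
  conv_lhs => rw [← filt_add_filt_not (fun b => ψ b = 0) f]
  have h1 : filt (fun m => χ m = α) (s * filt (fun b => ψ b = 0) f) =
      filt (fun m => φ m = α) s * filt (fun b => ψ b = 0) f := filt_mul fun a _ b hb => by
    rw [coeff_filt_ne_zero] at hb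
    rw [hχ, hb.2, add_zero]
  have h2 : filt (fun m => χ m = α) (s * filt (fun b => ¬ ψ b = 0) f) = 0 :=
    filt_eq_zero fun m hm hp => by
      obtain ⟨a, b, ha, hb, rfl⟩ := exists_of_coeff_mul_ne_zero hm
      rw [coeff_filt_ne_zero] at hb
      have h1 := hs a ha
      have h2 := lt_of_le_of_ne (hf b hb.1) (Ne.symm hb.2)
      rw [hχ] at hp
      linarith
  rw [mul_add, filt_add, h1, h2, add_zero]

end Filter

/-! ### Faces of cones and Koszul relations with controlled supports -/

section Foundation

variable {R : Type*} [CommRing R]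

/-- Weak regularity of `f 0, …, f (k - 1)`, in terms of linear combinations. -/
def WReg (k : ℕ) (f : ℕ → R) : Prop :=
  ∀ j < k, ∀ (s : R) (c : ℕ → R), s * f j = ∑ i ∈ Finset.range j, c i * f i →
    ∃ c' : ℕ → R, s = ∑ i ∈ Finset.range j, c' i * f i

/-- Exchanging the summation indices changes the sign, and `2` is invertible. This is what allows a
Koszul combination to be subtracted from the coefficients without changing the represented element.
-/
lemma sum_antisymm_eq_zero {R : Type*} [CommRing R] [Algebra ℂ R] (j : ℕ) (H : ℕ → ℕ → R)
    (f : ℕ → R) (hH : ∀ a b, H a b = - H b a) :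
    ∑ a ∈ Finset.range j, (∑ b ∈ Finset.range j, H a b * f b) * f a = 0 := by
  set X := ∑ a ∈ Finset.range j, (∑ b ∈ Finset.range j, H a b * f b) * f a with hX
  have h1 : X = -X := by
    conv_lhs => rw [hX]
    simp_rw [Finset.sum_mul]
    rw [Finset.sum_comm, hX, ← Finset.sum_neg_distrib]
    refine Finset.sum_congr rfl fun a _ => ?_
    rw [Finset.sum_mul, ← Finset.sum_neg_distrib]
    refine Finset.sum_congr rfl fun b _ => ?_
    rw [hH b a]; ring
  have h2 : (2 : ℂ) • X = 0 := by
    rw [two_smul]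
    nth_rewrite 1 [h1]
    simp
  exact (smul_eq_zero_iff_right (two_ne_zero)).1 h2

section Face

variable {G E : Type*} [AddCommGroup E] [Module ℝ E]

/-- `W` is the set of the points of `S` on a face of the cone over `S`. -/
def IsConeFace (h : G → E) (S W : Finset G) : Prop :=
  ∃ v : E →ₗ[ℝ] ℝ, (∀ b ∈ S, 0 ≤ v (h b)) ∧ ∀ b, b ∈ W ↔ b ∈ S ∧ v (h b) = 0

/-- The functional of the smaller face is controlled only on `W`; a large multiple of the functional
of `W` makes the sum positive on the rest of `S`. -/
lemma IsConeFace.trans {h : G → E} {S W F : Finset G} (hW : IsConeFace h S W)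
    (hF : IsConeFace h W F) : IsConeFace h S F := by
  classical
  obtain ⟨v, hv, hWv⟩ := hW
  obtain ⟨w, hw, hFw⟩ := hF
  obtain ⟨N, hN⟩ : ∃ N : ℝ, ∀ b ∈ S, 0 < v (h b) → 0 < N * v (h b) + w (h b) := by
    let Z : Finset ℝ := insert 0 ((S.filter fun b => 0 < v (h b)).image
      fun b => - w (h b) / v (h b))
    refine ⟨Z.max' (Finset.insert_nonempty _ _) + 1, fun b hb hb0 => ?_⟩
    have := Z.le_max' (- w (h b) / v (h b)) (Finset.mem_insert_of_mem
      (Finset.mem_image_of_mem _ (Finset.mem_filter.2 ⟨hb, hb0⟩)))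
    rw [div_le_iff₀ hb0] at this
    nlinarith
  refine ⟨N • v + w, fun b hb => ?_, fun b => ?_⟩
  · simp only [LinearMap.add_apply, LinearMap.smul_apply, smul_eq_mul]
    rcases (hv b hb).eq_or_lt with h0 | h0
    · rw [← h0, mul_zero, zero_add]
      exact hw b ((hWv b).2 ⟨hb, h0.symm⟩)
    · exact (hN b hb h0).le
  · simp only [LinearMap.add_apply, LinearMap.smul_apply, smul_eq_mul]
    rw [hFw, hWv]
    constructor
    · rintro ⟨⟨hb, h1⟩, h2⟩
      exact ⟨hb, by rw [h1, h2]; simp⟩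
    · rintro ⟨hb, h1⟩
      rcases (hv b hb).eq_or_lt with h0 | h0
      · rw [← h0, mul_zero, zero_add] at h1
        exact ⟨⟨hb, h0.symm⟩, h1⟩
      · exact absurd h1 (hN b hb h0).ne'

end Face

variable {G E : Type*} [AddCommGroup G] [AddCommGroup E] [Module ℝ E]

/-- The exponents `m` for which `m`, shifted by `e`, lies in the cone over `W`. -/
def coneSupp (ι : G →+ E) (u : E) (W : Finset G) (e : E) : Set G :=
  {m | ι m + e ∈ coneOf (fun b => ι b + u) W}

/-- The ideal membership problem for the restrictions of `f 0, …, f (j - 1)` to `W` can be solved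
with the expected supports. -/
def Effective (ι : G →+ E) (u : E) (f : ℕ → AddMonoidAlgebra ℂ G) (j : ℕ) (W : Finset G) : Prop :=
  ∀ (e : E) (g : AddMonoidAlgebra ℂ G) (c : ℕ → AddMonoidAlgebra ℂ G),
    g = ∑ i ∈ Finset.range j, c i * filt (· ∈ W) (f i) →
    g ∈ suppOn (coneSupp ι u W (e + u)) →
    ∃ s : ℕ → AddMonoidAlgebra ℂ G, (∀ i, s i ∈ suppOn (coneSupp ι u W e)) ∧
      g = ∑ i ∈ Finset.range j, s i * filt (· ∈ W) (f i)

variable {ι : G →+ E} {u : E} {f : ℕ → AddMonoidAlgebra ℂ G}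

lemma add_mem_coneSupp {W : Finset G} {e e' : E} (he : e' = e + u) {m b : G}
    (hm : m ∈ coneSupp ι u W e) (hb : b ∈ W) : m + b ∈ coneSupp ι u W e' := by
  have := add_mem_coneOf hm (gen_mem_coneOf (h := fun b => ι b + u) hb)
  have h2 : ι (m + b) + e' = ι m + e + (ι b + u) := by rw [he, map_add]; abel
  change _ ∈ coneOf _ _
  rwa [h2]

/-- Relations between weakly regular Laurent polynomials are Koszul relations with the expected
supports. -/
lemma exists_antisymm_of_relation {W : Finset G} {k : ℕ}
    (hreg : WReg k fun i => filt (· ∈ W) (f i)) (j : ℕ) (hj : j ≤ k)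
    (hE : ∀ i < j, Effective ι u f i W) (e : E) (s : ℕ → AddMonoidAlgebra ℂ G)
    (hs : ∀ i < j, s i ∈ suppOn (coneSupp ι u W e))
    (h0 : ∑ i ∈ Finset.range j, s i * filt (· ∈ W) (f i) = 0) :
    ∃ H : ℕ → ℕ → AddMonoidAlgebra ℂ G, (∀ a b, H a b ∈ suppOn (coneSupp ι u W (e - u))) ∧
      (∀ a b, H a b = - H b a) ∧
      ∀ a < j, s a = ∑ b ∈ Finset.range j, H a b * filt (· ∈ W) (f b) := by
  classical
  induction j generalizing s with
  | zero => exact ⟨fun _ _ => 0, fun _ _ => Submodule.zero_mem _, by simp, by simp⟩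
  | succ j ih =>
    set F : ℕ → AddMonoidAlgebra ℂ G := fun i => filt (· ∈ W) (f i) with hF
    rw [Finset.sum_range_succ] at h0
    -- Regularity puts the last coefficient into the ideal of the earlier polynomials, and
    -- effectivity finds coefficients `t` one step lower. Moving these terms to the other indices
    -- leaves a shorter relation.
    obtain ⟨c, hc⟩ := hreg j hj (s j) (fun i => - s i) (by
      simp only [neg_mul, Finset.sum_neg_distrib]
      exact eq_neg_of_add_eq_zero_right h0)
    obtain ⟨t, ht, hst⟩ := hE j (Nat.lt_succ_self j) (e - u) (s j) c hc (by
      rw [sub_add_cancel]; exact hs j (Nat.lt_succ_self j))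
    obtain ⟨H, hH1, hH2, hH3⟩ := ih (Nat.le_of_succ_le hj) (fun i hi => hE i (Nat.lt_succ_of_lt hi))
      (fun i => s i + t i * F j) (fun i hi => Submodule.add_mem _ (hs i (Nat.lt_succ_of_lt hi))
        (mul_mem_suppOn (ht i) (filt_mem_suppOn_self W (f j))
          fun a ha b hb => add_mem_coneSupp (sub_add_cancel e u).symm ha hb)) (by
        have h1 : (s j) * F j = ∑ i ∈ Finset.range j, t i * F j * F i := by
          rw [hst, Finset.sum_mul]
          exact Finset.sum_congr rfl fun i _ => by ring
        rw [← h0]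
        simp only [add_mul, Finset.sum_add_distrib]
        rw [← h1])
    -- The antisymmetric matrix of the shorter relation, bordered by the row `t` and the column
    -- `-t`.
    refine ⟨fun a b => if a < j ∧ b < j then H a b else if a = j ∧ b < j then t b else
      if a < j ∧ b = j then - t a else 0, fun a b => ?_, fun a b => ?_, fun a ha => ?_⟩
    · dsimp only
      split_ifs
      · exact hH1 a b
      · exact ht b
      · exact Submodule.neg_mem _ (ht a)
      · exact Submodule.zero_mem _
    · by_cases h1 : a < j <;> by_cases h2 : b < j <;> by_cases h3 : a = j <;>
        by_cases h4 : b = j <;> simp [h1, h2, h3, h4]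
      exact hH2 a b
    · rw [Finset.sum_range_succ]
      rcases Nat.lt_succ_iff_lt_or_eq.1 ha with ha | rfl
      · have h1 := hH3 a ha
        have h2 : ∑ b ∈ Finset.range j, (if a < j ∧ b < j then H a b else if a = j ∧ b < j then t b
            else if a < j ∧ b = j then - t a else 0) * F b = ∑ b ∈ Finset.range j, H a b * F b :=
          Finset.sum_congr rfl fun b hb => by simp [ha, Finset.mem_range.1 hb]
        change s a = ∑ b ∈ Finset.range j, _ * F b + _ * F j
        rw [h2, ← h1]
        simp [ha, ha.ne]
      · simp only [lt_irrefl, false_and, and_false, if_false, zero_mul, add_zero]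
        rw [hst]
        exact Finset.sum_congr rfl fun b hb => by simp [Finset.mem_range.1 hb]

end Foundation

end EffMember

/-! ### Descent on the level along a generic direction -/

namespace EffMember

variable {G E : Type*} [AddCommGroup G] [AddCommGroup E] [Module ℝ E]
  {ι : G →+ E} {u : E} {f : ℕ → AddMonoidAlgebra ℂ G}

/-- Cancelling the part of the coefficients `s` of the highest level `ρ`. -/
lemma exists_lower_level [Countable G] [FiniteDimensional ℝ E] {W : Finset G} {k j : ℕ}
    (hj0 : 0 < j) (hjk : j ≤ k)
    (hrank : j + 1 ≤ Module.finrank ℝ (Submodule.span ℝ ((fun b => ι b + u) '' W)))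
    (hreg : ∀ F, IsConeFace (fun b => ι b + u) W F → F ≠ W → F.Nonempty →
      WReg k fun i => filt (· ∈ F) (f i))
    (hE : ∀ F, IsConeFace (fun b => ι b + u) W F →
      j ≤ Module.finrank ℝ (Submodule.span ℝ ((fun b => ι b + u) '' F)) →
      ∀ i < j, Effective ι u f i F)
    {e : E} {g : AddMonoidAlgebra ℂ G} (hg : g ∈ suppOn (coneSupp ι u W (e + u)))
    {I : Finset (E →ₗ[ℝ] ℝ)}
    (hI : ∀ x, x ∈ coneOf (fun b => ι b + u) W ↔ ∀ v ∈ I, 0 ≤ v x)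
    {a : E} (ha : a ∈ Submodule.span ℝ ((fun b => ι b + u) '' W))
    (hN1 : ∀ (m : G) (v : E →ₗ[ℝ] ℝ) (F : Finset G), v ∈ I →
      (∀ b, b ∈ F ↔ b ∈ W ∧ v (ι b + u) = 0) →
      a ∈ Submodule.span ℝ ((fun b => ι b + u) '' F) ⊔ Submodule.span ℝ {ι m + e} →
      Submodule.span ℝ ((fun b => ι b + u) '' W) ≤
        Submodule.span ℝ ((fun b => ι b + u) '' F) ⊔ Submodule.span ℝ {ι m + e})
    (hN2 : ∀ (m m' : G), ∀ v ∈ I, ∀ v' ∈ I,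
      v (ι m + e) * v' a - v' (ι m' + e) * v a = 0 →
      ∀ x ∈ Submodule.span ℝ ((fun b => ι b + u) '' W),
        v (ι m + e) * v' x - v' (ι m' + e) * v x = 0)
    {r : G → ℝ}
    (hr1 : ∀ m, ι m + e ∈ Submodule.span ℝ ((fun b => ι b + u) '' W) → ∀ ρ : ℝ, 0 ≤ ρ →
      (ι m + e + ρ • a ∈ coneOf (fun b => ι b + u) W ↔ r m ≤ ρ))
    (hr2 : ∀ m, ι m + e ∈ Submodule.span ℝ ((fun b => ι b + u) '' W) → 0 < r m →
      ∃ v ∈ I, 0 < v a ∧ v (ι m + e) = - (r m * v a))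
    {ρ : ℝ} (hρ : 0 < ρ) {s : ℕ → AddMonoidAlgebra ℂ G}
    (hs : ∀ i, s i ∈ suppOn {m | ι m + e ∈ Submodule.span ℝ ((fun b => ι b + u) '' W) ∧ r m ≤ ρ})
    (hgs : g = ∑ i ∈ Finset.range j, s i * filt (· ∈ W) (f i))
    {m₀ : G} (hm₀ : ι m₀ + e ∈ Submodule.span ℝ ((fun b => ι b + u) '' W)) (hrm₀ : r m₀ = ρ) :
    ∃ s' : ℕ → AddMonoidAlgebra ℂ G,
      (∀ i, s' i ∈
        suppOn {m | ι m + e ∈ Submodule.span ℝ ((fun b => ι b + u) '' W) ∧ r m < ρ}) ∧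
      g = ∑ i ∈ Finset.range j, s' i * filt (· ∈ W) (f i) := by
  classical
  set h : G → E := fun b => ι b + u with hh
  set E' := Submodule.span ℝ (h '' W) with hE'
  obtain ⟨v, hvI, hva, hvm₀⟩ := hr2 m₀ hm₀ (hrm₀ ▸ hρ)
  rw [hrm₀] at hvm₀
  have hvW : ∀ b ∈ W, 0 ≤ v (h b) := fun b hb => (hI _).1 (gen_mem_coneOf hb) v hvI
  -- all exponents of level `ρ` lie on the same facet
  have huniq : ∀ m, ι m + e ∈ E' → r m = ρ → v (ι m + e) = - (ρ * v a) := by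
    intro m hm hrm
    obtain ⟨w, hwI, hwa, hwm⟩ := hr2 m hm (hrm ▸ hρ)
    rw [hrm] at hwm
    -- The two equations of level `ρ` make this combination of `v` and `w` vanish at the generic
    -- point `a`, hence on the whole span, in particular at `ι m + e`.
    have h1 := hN2 m₀ m v hvI w hwI (by rw [hvm₀, hwm]; ring) (ι m + e) hm
    have h2 : w (ι m + e) ≠ 0 := by
      rw [hwm]
      exact neg_ne_zero.2 (mul_pos hρ hwa).ne'
    rw [← hvm₀]
    have h3 : w (ι m + e) * (v (ι m₀ + e) - v (ι m + e)) = 0 := by linarith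
    exact (sub_eq_zero.1 ((mul_eq_zero.1 h3).resolve_left h2)).symm
  set F : Finset G := W.filter fun b => v (h b) = 0 with hF
  have hFW : F ⊆ W := Finset.filter_subset _ _
  have hFface : IsConeFace h W F := ⟨v, hvW, fun b => by simp [hF]⟩
  have hFne : F ≠ W := by
    intro hFe
    have : E' ≤ LinearMap.ker v := by
      rw [hE', Submodule.span_le]
      rintro _ ⟨b, hb, rfl⟩
      exact (Finset.mem_filter.1 (hFe ▸ hb : b ∈ F)).2
    exact hva.ne' (this ha)
  have hcone : ∀ m, ι m + e ∈ E' → r m ≤ ρ → ι m + e + ρ • a ∈ coneOf h W := fun m hm hrm =>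
    (hr1 m hm ρ hρ.le).2 hrm
  have hconeF : ∀ m, ι m + e ∈ E' → r m ≤ ρ → v (ι m + e) = - (ρ * v a) →
      m ∈ coneSupp ι u F (e + ρ • a) := by
    intro m hm hrm hv
    have h1 := mem_coneOf_face (hcone m hm hrm) v hvW (by
      rw [map_add, hv, map_smul, smul_eq_mul]; ring)
    change ι m + (e + ρ • a) ∈ coneOf _ _
    rw [← add_assoc]
    exact h1
  -- Moving `ι m₀ + e` by `ρ • a` lands in the span of `F`, so `a` lies in that span plus one line.
  -- By genericity so does the span of `W`, and the rank drops by at most one.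
  have hrankF : j ≤ Module.finrank ℝ (Submodule.span ℝ (h '' F)) := by
    have h1 : a ∈ Submodule.span ℝ (h '' F) ⊔ Submodule.span ℝ {ι m₀ + e} := by
      have h2 := mem_span_of_mem_coneOf (hconeF m₀ hm₀ hrm₀.le hvm₀)
      have h3 : ρ • a ∈ Submodule.span ℝ (h '' F) ⊔ Submodule.span ℝ {ι m₀ + e} := by
        have : ρ • a = (ι m₀ + (e + ρ • a)) - (ι m₀ + e) := by abel
        rw [this]
        exact Submodule.sub_mem _ (Submodule.mem_sup_left h2)
          (Submodule.mem_sup_right (Submodule.mem_span_singleton_self _))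
      simpa [smul_smul, inv_mul_cancel₀ hρ.ne'] using Submodule.smul_mem _ ρ⁻¹ h3
    have h2 := Submodule.finrank_mono (hN1 m₀ v F hvI (fun b => by simp [hF, hh]) h1)
    have h3 := Submodule.finrank_add_le_finrank_add_finrank (Submodule.span ℝ (h '' F))
      (Submodule.span ℝ {ι m₀ + e})
    have h4 := finrank_span_le_card (R := ℝ) ({ι m₀ + e} : Set E)
    simp only [Set.toFinset_singleton, Finset.card_singleton] at h4
    omega
  have hFnonempty : F.Nonempty := by
    rw [Finset.nonempty_iff_ne_empty]
    intro h0
    rw [h0, Finset.coe_empty, Set.image_empty, Submodule.span_empty, finrank_bot] at hrankF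
    omega
  -- the relation between the parts of level `ρ`
  set s1 : ℕ → AddMonoidAlgebra ℂ G := fun i => filt (fun m => v (ι m + e) = - (ρ * v a)) (s i)
    with hs1
  have hs1F : ∀ i, s1 i ∈ suppOn (coneSupp ι u F (e + ρ • a)) := fun i =>
    filt_mem_suppOn (hs i) fun m hm hp => hconeF m hm.1 hm.2 hp
  have hfF : ∀ i, filt (· ∈ F) (f i) = filt (fun b => v (h b) = 0) (filt (· ∈ W) (f i)) :=
    fun i => filt_filt (fun m => by simp [hF]) _
  have hrel : ∑ i ∈ Finset.range j, s1 i * filt (· ∈ F) (f i) = 0 := by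
    -- The shifted exponents of `g` lie in the cone, where `v` is nonnegative, whereas `-(ρ * v a)`
    -- is negative.
    have h1 : filt (fun m => v (ι m + (e + u)) = - (ρ * v a)) g = 0 := by
      refine filt_eq_zero fun m hm hp => ?_
      have h2 := nonneg_of_mem_coneOf (mem_suppOn.1 hg m hm) v hvW
      have h3 := mul_pos hρ hva
      linarith
    rw [← h1, hgs, filt_sum]
    refine Finset.sum_congr rfl fun i _ => ?_
    rw [hfF, filt_mul_initial (φ := fun m => v (ι m + e)) (ψ := fun b => v (h b))]
    · intro m b
      rw [← map_add]
      congr 1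
      simp only [hh, map_add]
      abel
    · intro m hm
      have h2 := mem_suppOn.1 (hs i) m hm
      have h3 := nonneg_of_mem_coneOf (hcone m h2.1 h2.2) v hvW
      rw [map_add, map_smul, smul_eq_mul] at h3
      linarith
    · intro b hb
      exact hvW b (coeff_filt_ne_zero.1 hb).2
  obtain ⟨H, hH1, hH2, hH3⟩ := exists_antisymm_of_relation (hreg F hFface hFne hFnonempty) j hjk
    (hE F hFface hrankF) (e + ρ • a) s1 (fun i _ => hs1F i) hrel
  refine ⟨fun i => if i < j then
    s i - ∑ b ∈ Finset.range j, H i b * filt (· ∈ W) (f b) else 0, fun i => ?_, ?_⟩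
  · dsimp only
    split_ifs with hi
    swap
    · exact Submodule.zero_mem _
    -- The part of the Koszul combination coming from `F` cancels the top part of `s i`. The
    -- remaining terms involve generators off `F`, which raise `v` strictly and so leave the
    -- hyperplane of level `ρ`.
    have hdec : s i - ∑ b ∈ Finset.range j, H i b * filt (· ∈ W) (f b) =
        filt (fun m => ¬ v (ι m + e) = - (ρ * v a)) (s i) -
          ∑ b ∈ Finset.range j, H i b * filt (fun b => ¬ v (h b) = 0) (filt (· ∈ W) (f b)) := by
      have h1 : ∀ b, H i b * filt (· ∈ W) (f b) = H i b * filt (· ∈ F) (f b) +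
          H i b * filt (fun b => ¬ v (h b) = 0) (filt (· ∈ W) (f b)) := fun b => by
        rw [← mul_add, hfF, filt_add_filt_not]
      have h2 := filt_add_filt_not (fun m => v (ι m + e) = - (ρ * v a)) (s i)
      have h3 := hH3 i hi
      simp_rw [h1]
      rw [Finset.sum_add_distrib, ← h3]
      conv_lhs => rw [← h2]
      simp only [hs1]
      abel
    rw [hdec]
    refine Submodule.sub_mem _ ?_ (Submodule.sum_mem _ fun b _ => ?_)
    · refine filt_mem_suppOn (hs i) fun m hm hp => ⟨hm.1, lt_of_le_of_ne hm.2 fun hrm => ?_⟩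
      exact hp (huniq m hm.1 hrm)
    · have hfb : filt (fun b => ¬ v (h b) = 0) (filt (· ∈ W) (f b)) ∈
          suppOn {b | b ∈ W ∧ ¬ v (h b) = 0} :=
        filt_mem_suppOn (filt_mem_suppOn_self W (f b)) fun m hm hp => ⟨hm, hp⟩
      refine mul_mem_suppOn (hH1 i b) hfb ?_
      rintro q hq b' ⟨hb', hvb'⟩
      have h1 : ι (q + b') + e + ρ • a = (ι q + (e + ρ • a - u)) + h b' := by
        simp only [hh, map_add]
        abel
      have hq' : ι q + (e + ρ • a - u) ∈ coneOf h F := hq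
      have h2 : ι (q + b') + e + ρ • a ∈ coneOf h W := by
        rw [h1]
        exact add_mem_coneOf (coneOf_mono hFW hq') (gen_mem_coneOf hb')
      have h3 : ι (q + b') + e ∈ E' := by
        have := Submodule.sub_mem _ (mem_span_of_mem_coneOf h2) (Submodule.smul_mem _ ρ ha)
        rwa [add_sub_cancel_right] at this
      refine ⟨h3, lt_of_le_of_ne ((hr1 _ h3 ρ hρ.le).1 h2) fun hrm => ?_⟩
      have h4 := huniq _ h3 hrm
      have h5 : v (ι (q + b') + e + ρ • a) = 0 := by
        rw [map_add, h4, map_smul, smul_eq_mul]; ring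
      have h6 : v (ι q + (e + ρ • a - u)) = 0 := by
        obtain ⟨c, -, hc⟩ := hq'
        rw [hc, map_sum]
        refine Finset.sum_eq_zero fun b hb => ?_
        rw [map_smul, (Finset.mem_filter.1 hb).2, smul_zero]
      rw [h1, map_add, h6, zero_add] at h5
      exact hvb' h5
  · have h1 : ∑ i ∈ Finset.range j, (if i < j then
        s i - ∑ b ∈ Finset.range j, H i b * filt (· ∈ W) (f b) else 0) * filt (· ∈ W) (f i) =
        ∑ i ∈ Finset.range j, (s i * filt (· ∈ W) (f i) -
          (∑ b ∈ Finset.range j, H i b * filt (· ∈ W) (f b)) * filt (· ∈ W) (f i)) :=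
      Finset.sum_congr rfl fun i hi => by rw [if_pos (Finset.mem_range.1 hi), sub_mul]
    rw [h1, Finset.sum_sub_distrib, sum_antisymm_eq_zero j H _ hH2, sub_zero, hgs]

end EffMember

namespace EffMember

variable {G E : Type*} [AddCommGroup E] [Module ℝ E]

lemma IsConeFace.subset {h : G → E} {S W : Finset G} (hW : IsConeFace h S W) : W ⊆ S := by
  obtain ⟨v, -, hv⟩ := hW
  exact fun b hb => ((hv b).1 hb).1

lemma exists_bound_on_supports (j : ℕ) (s : ℕ → AddMonoidAlgebra ℂ G) (hs : ∀ i, j ≤ i → s i = 0)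
    (r : G → ℝ) : ∃ R₀ : ℝ, 0 ≤ R₀ ∧ ∀ i m, (s i).coeff m ≠ 0 → r m ≤ R₀ := by
  classical
  let Z : Finset ℝ := insert 0 (((Finset.range j).biUnion fun i => (s i).coeff.support).image r)
  refine ⟨Z.max' (Finset.insert_nonempty _ _), Z.le_max' 0 (Finset.mem_insert_self _ _),
    fun i m hm => Z.le_max' _ (Finset.mem_insert_of_mem (Finset.mem_image_of_mem _ ?_))⟩
  refine Finset.mem_biUnion.2 ⟨i, Finset.mem_range.2 ?_, Finsupp.mem_support_iff.2 hm⟩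
  by_contra hij
  exact hm (by simp [hs i (not_lt.1 hij)])

lemma exists_max_on_supports (j : ℕ) (s : ℕ → AddMonoidAlgebra ℂ G)
    (r : G → ℝ) (hne : ∃ i < j, ∃ m, (s i).coeff m ≠ 0 ∧ 0 < r m) :
    ∃ i < j, ∃ m, (s i).coeff m ≠ 0 ∧ 0 < r m ∧ ∀ i' < j, ∀ m', (s i').coeff m' ≠ 0 →
      r m' ≤ r m := by
  classical
  obtain ⟨i₀, hi₀, m₀, hm₀, hr₀⟩ := hne
  let T : Finset G := (Finset.range j).biUnion fun i => (s i).coeff.support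
  have hT : ∀ m, m ∈ T ↔ ∃ i < j, (s i).coeff m ≠ 0 := fun m => by simp [T]
  obtain ⟨m, hm, hmax⟩ := T.exists_max_image r ⟨m₀, (hT m₀).2 ⟨i₀, hi₀, hm₀⟩⟩
  obtain ⟨i, hi, him⟩ := (hT m).1 hm
  exact ⟨i, hi, m, him, hr₀.trans_le (hmax m₀ ((hT m₀).2 ⟨i₀, hi₀, hm₀⟩)),
    fun i' hi' m' hm' => hmax m' ((hT m').2 ⟨i', hi', hm'⟩)⟩

variable [AddCommGroup G] {ι : G →+ E} {u : E} {f : ℕ → AddMonoidAlgebra ℂ G}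

/-- Each condition says that a certain subspace contains the whole span of the generators once it
contains the chosen point. The subspaces are indexed by exponents and functionals of `I`, hence
countable in number, and those not containing the span can be avoided together. -/
lemma exists_generic_direction [Countable G] [FiniteDimensional ℝ E] (W : Finset G) (e : E)
    (I : Finset (E →ₗ[ℝ] ℝ)) :
    ∃ c : G → ℝ, (∀ b ∈ W, 0 < c b) ∧
      (∀ (m : G) (v : E →ₗ[ℝ] ℝ) (F : Finset G), v ∈ I →
        (∀ b, b ∈ F ↔ b ∈ W ∧ v (ι b + u) = 0) →
        ∑ b ∈ W, c b • (ι b + u) ∈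
          Submodule.span ℝ ((fun b => ι b + u) '' F) ⊔ Submodule.span ℝ {ι m + e} →
        Submodule.span ℝ ((fun b => ι b + u) '' W) ≤
          Submodule.span ℝ ((fun b => ι b + u) '' F) ⊔ Submodule.span ℝ {ι m + e}) ∧
      ∀ (m m' : G), ∀ v ∈ I, ∀ v' ∈ I,
        v (ι m + e) * v' (∑ b ∈ W, c b • (ι b + u)) -
          v' (ι m' + e) * v (∑ b ∈ W, c b • (ι b + u)) = 0 →
        ∀ x ∈ Submodule.span ℝ ((fun b => ι b + u) '' W),
          v (ι m + e) * v' x - v' (ι m' + e) * v x = 0 := by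
  classical
  let h : G → E := fun b => ι b + u
  let N : (G × I) ⊕ (G × G × I × I) → Submodule ℝ E := Sum.elim
    (fun p => Submodule.span ℝ (h '' (W.filter fun b => (p.2 : E →ₗ[ℝ] ℝ) (h b) = 0)) ⊔
      Submodule.span ℝ {ι p.1 + e})
    (fun p => LinearMap.ker ((p.2.2.1 : E →ₗ[ℝ] ℝ) (ι p.1 + e) • (p.2.2.2 : E →ₗ[ℝ] ℝ) -
      (p.2.2.2 : E →ₗ[ℝ] ℝ) (ι p.2.1 + e) • (p.2.2.1 : E →ₗ[ℝ] ℝ)))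
  obtain ⟨c, hc, hcN⟩ := exists_generic_point h W
    (fun i : {i // ¬ Submodule.span ℝ (h '' W) ≤ N i} => N i) (fun i => i.2)
  have key : ∀ i, ∑ b ∈ W, c b • h b ∈ N i → Submodule.span ℝ (h '' W) ≤ N i := by
    intro i hi
    by_contra hcon
    exact hcN ⟨i, hcon⟩ hi
  refine ⟨c, hc, fun m v F hv hF hmem => ?_, fun m m' v hv v' hv' h0 x hx => ?_⟩
  · have hFe : F = W.filter fun b => v (h b) = 0 := by
      ext b
      rw [hF, Finset.mem_filter]
    have := key (Sum.inl (m, ⟨v, hv⟩))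
    simp only [N, Sum.elim_inl, ← hFe] at this
    exact this hmem
  · have := key (Sum.inr (m, m', ⟨v, hv⟩, ⟨v', hv'⟩))
    simp only [N, Sum.elim_inr] at this
    have h1 := this (by
      rw [LinearMap.mem_ker]
      simpa only [LinearMap.sub_apply, LinearMap.smul_apply, smul_eq_mul] using h0) hx
    rw [LinearMap.mem_ker] at h1
    simpa only [LinearMap.sub_apply, LinearMap.smul_apply, smul_eq_mul] using h1

/-- One induction step for `effective_of_regular_faces`. -/
lemma effective_step [Countable G] [FiniteDimensional ℝ E] {W : Finset G} {k j : ℕ}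
    (hfin : ∀ e, (coneSupp ι u W e).Finite)
    (hjk : j ≤ k) (hrank : j + 1 ≤ Module.finrank ℝ (Submodule.span ℝ ((fun b => ι b + u) '' W)))
    (hreg : ∀ F, IsConeFace (fun b => ι b + u) W F → F ≠ W → F.Nonempty →
      WReg k fun i => filt (· ∈ F) (f i))
    (hE : ∀ F, IsConeFace (fun b => ι b + u) W F →
      j ≤ Module.finrank ℝ (Submodule.span ℝ ((fun b => ι b + u) '' F)) →
      ∀ i < j, Effective ι u f i F) :
    Effective ι u f j W := by
  classical
  intro e g c hgc hg
  set h : G → E := fun b => ι b + u with hh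
  set E' := Submodule.span ℝ (h '' W) with hE'
  obtain ⟨I, hI⟩ := exists_dual_coneOf h W
  obtain ⟨w, hw, hN1, hN2⟩ := exists_generic_direction (ι := ι) (u := u) W e I
  set a : E := ∑ b ∈ W, w b • (ι b + u) with ha
  have haE : a ∈ E' := Submodule.sum_mem _ fun b hb =>
    Submodule.smul_mem _ _ (Submodule.subset_span ⟨b, hb, rfl⟩)
  -- The level has meaning only inside the span; outside it an arbitrary value is used.
  have hgauge : ∀ m, ∃ r : ℝ, ι m + e ∈ E' → 0 ≤ r ∧
      (∀ ρ : ℝ, 0 ≤ ρ → (ι m + e + ρ • a ∈ coneOf h W ↔ r ≤ ρ)) ∧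
      (0 < r → ∃ v ∈ I, 0 < v a ∧ v (ι m + e) = - (r * v a)) := by
    intro m
    by_cases hm : ι m + e ∈ E'
    · obtain ⟨r, hr⟩ := exists_gauge hI hw ha hm
      exact ⟨r, fun _ => hr⟩
    · exact ⟨0, fun hm' => absurd hm' hm⟩
  choose r hr using hgauge
  -- Terms off the span can be dropped: multiplication by a generator preserves membership in the
  -- span, and `g` lies in it.
  set s₀ : ℕ → AddMonoidAlgebra ℂ G := fun i =>
    if i < j then filt (fun m => ι m + e ∈ E') (c i) else 0 with hs₀
  obtain ⟨R₀, hR₀, hR₀s⟩ := exists_bound_on_supports j s₀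
    (fun i hi => by simp [hs₀, not_lt.2 hi]) r
  -- All exponents of level at most `R₀` lie in one finite set, so only finitely many levels can
  -- occur. Their number below `ρ` is the induction measure.
  set Z : Finset ℝ := (hfin (e + R₀ • a)).toFinset.image r with hZ
  have main : ∀ (N : ℕ) (ρ : ℝ) (s : ℕ → AddMonoidAlgebra ℂ G), (Z.filter (· < ρ)).card ≤ N →
      (∀ i, s i ∈ suppOn {m | ι m + e ∈ E' ∧ r m < ρ ∧ r m ≤ R₀}) →
      g = ∑ i ∈ Finset.range j, s i * filt (· ∈ W) (f i) →
      ∃ s : ℕ → AddMonoidAlgebra ℂ G, (∀ i, s i ∈ suppOn (coneSupp ι u W e)) ∧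
        g = ∑ i ∈ Finset.range j, s i * filt (· ∈ W) (f i) := by
    intro N
    induction N with
    | zero | succ N ih =>
      intro ρ s hcard hs hgs
      by_cases hne : ∃ i < j, ∃ m, (s i).coeff m ≠ 0 ∧ 0 < r m
      · obtain ⟨i, hi, m, him, hrm, hmax⟩ := exists_max_on_supports j s r hne
        have hm := mem_suppOn.1 (hs i) m him
        have hmZ : r m ∈ Z.filter (· < ρ) := by
          refine Finset.mem_filter.2 ⟨Finset.mem_image_of_mem _ ?_, hm.2.1⟩
          rw [Set.Finite.mem_toFinset]
          change ι m + (e + R₀ • a) ∈ coneOf _ _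
          rw [← add_assoc]
          exact ((hr m hm.1).2.1 R₀ hR₀).2 hm.2.2
        first
        | exact absurd (Finset.card_pos.2 ⟨_, hmZ⟩) (by omega)
        | obtain ⟨v, hvI, hva, hvm⟩ := (hr m hm.1).2.2 hrm
          obtain ⟨s', hs', hgs'⟩ := exists_lower_level (ρ := r m)
            (s := fun i => if i < j then s i else 0) (f := f) (Nat.zero_lt_of_lt hi) hjk hrank
            hreg hE hg hI haE hN1 hN2
            (fun m hm => (hr m hm).2.1) (fun m hm => (hr m hm).2.2) hrm (fun i => by
              split_ifs with hij
              · exact mem_suppOn.2 fun m' hm' =>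
                  ⟨(mem_suppOn.1 (hs i) m' hm').1, hmax i hij m' hm'⟩
              · exact Submodule.zero_mem _)
            (by
              rw [hgs]
              exact Finset.sum_congr rfl fun i hi => by simp only [if_pos (Finset.mem_range.1 hi)])
            hm.1 rfl
          refine ih (r m) s' ?_ (fun i => mem_suppOn.2 fun m' hm' => ?_) hgs'
          · have hlt : (Z.filter (· < r m)).card < (Z.filter (· < ρ)).card := by
              refine Finset.card_lt_card ⟨fun y hy => ?_, fun hsub => ?_⟩
              · rw [Finset.mem_filter] at hy ⊢
                exact ⟨hy.1, hy.2.trans hm.2.1⟩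
              · exact lt_irrefl _ (Finset.mem_filter.1 (hsub hmZ)).2
            omega
          · have := mem_suppOn.1 (hs' i) m' hm'
            exact ⟨this.1, this.2, this.2.le.trans hm.2.2⟩
      · push Not at hne
        refine ⟨fun i => if i < j then s i else 0, fun i => ?_, ?_⟩
        · dsimp only
          split_ifs with hij
          · refine mem_suppOn.2 fun m hm => ?_
            have h1 := mem_suppOn.1 (hs i) m hm
            have h2 := ((hr m h1.1).2.1 0 le_rfl).2 (hne i hij m hm)
            rw [zero_smul, add_zero] at h2
            exact h2
          · exact Submodule.zero_mem _
        · rw [hgs]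
          exact Finset.sum_congr rfl fun i hi => by simp only [if_pos (Finset.mem_range.1 hi)]
  -- The bound on levels in `main` is strict, hence `R₀ + 1`.
  refine main _ (R₀ + 1) s₀ le_rfl (fun i => mem_suppOn.2 fun m hm => ?_) ?_
  · have h1 := hR₀s i m hm
    refine ⟨?_, by linarith, h1⟩
    by_cases hij : i < j
    · simp only [hs₀, if_pos hij] at hm
      exact (coeff_filt_ne_zero.1 hm).2
    · simp [hs₀, hij] at hm
  · have h1 : filt (fun m => ι m + (e + u) ∈ E') g = g := filt_eq_self fun m hm =>
      mem_span_of_mem_coneOf (mem_suppOn.1 hg m hm)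
    rw [← h1]
    conv_lhs => rw [hgc]
    rw [filt_sum]
    refine Finset.sum_congr rfl fun i hi => ?_
    simp only [hs₀, if_pos (Finset.mem_range.1 hi)]
    refine filt_mul fun m _ b hb => ?_
    have hbE : h b ∈ E' := Submodule.subset_span ⟨b, (coeff_filt_ne_zero.1 hb).2, rfl⟩
    have h2 : ι (m + b) + (e + u) = (ι m + e) + h b := by
      simp only [hh, map_add]; abel
    rw [h2]
    exact Submodule.add_mem_iff_left _ hbE

/-- If the restrictions to all proper faces are weakly regular, then the ideal membership problem
can be solved with the expected supports. -/
theorem effective_of_regular_faces [Countable G] [FiniteDimensional ℝ E] {S : Finset G} {k : ℕ}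
    (hfin : ∀ e, (coneSupp ι u S e).Finite)
    (hreg : ∀ F, IsConeFace (fun b => ι b + u) S F → F ≠ S → F.Nonempty →
      WReg k fun i => filt (· ∈ F) (f i)) (j : ℕ) (hjk : j ≤ k)
    (hrank : j + 1 ≤ Module.finrank ℝ (Submodule.span ℝ ((fun b => ι b + u) '' S))) :
    Effective ι u f j S := by
  induction j using Nat.strong_induction_on generalizing S with
  | _ j ih =>
    -- On `F` only `i < j` polynomials are needed, so rank `j` suffices there. A proper face of `F`
    -- is a proper face of `S`, so the regularity hypothesis is inherited.
    refine effective_step hfin hjk hrank hreg fun F hF hrF i hi => ?_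
    have hFS := hF.subset
    refine ih i hi (fun e => (hfin e).subset fun m hm => coneOf_mono hFS hm)
      (fun F' hF' hne => hreg F' (hF.trans hF') fun h => hne ?_) (by omega) (by omega)
    exact (hF'.subset).antisymm (h ▸ hFS)

end EffMember

namespace EffMember

/-! ### Generic flatness by leading monomials -/

section GenericFreeness

variable {A : Type*} [CommRing A] {N : ℕ}

open MvPolynomial MonomialOrder

/-- Dickson's lemma for the leading monomials of an ideal. -/
lemma exists_finset_leading (m : MonomialOrder (Fin N)) (J : Ideal (MvPolynomial (Fin N) A)) :
    ∃ T : Finset (MvPolynomial (Fin N) A), (∀ q ∈ T, q ∈ J ∧ q ≠ 0) ∧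
      ∀ q ∈ J, q ≠ 0 → ∃ p ∈ T, m.degree p ≤ m.degree q := by
  classical
  let P : (Fin N →₀ ℕ) → Prop := fun d => ∃ q ∈ J, q ≠ 0 ∧ m.degree q = d
  have hfin : {d | Minimal P d}.Finite :=
    WellQuasiOrderedLE.finite_of_isAntichain (setOfPred_minimal_antichain P)
  have hch : ∀ d : {d // Minimal P d}, ∃ q ∈ J, q ≠ 0 ∧ m.degree q = d := fun d => d.2.1
  choose q hq using hch
  have : Fintype {d // Minimal P d} := hfin.fintype
  refine ⟨Finset.univ.image q, fun p hp => ?_, fun p hpJ hp0 => ?_⟩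
  · obtain ⟨d, -, rfl⟩ := Finset.mem_image.1 hp
    exact ⟨(hq d).1, (hq d).2.1⟩
  · obtain ⟨d, hd, hdm⟩ := exists_minimal_le_of_wellFoundedLT P (m.degree p) ⟨p, hpJ, hp0, rfl⟩
    exact ⟨q ⟨d, hdm⟩, Finset.mem_image_of_mem _ (Finset.mem_univ _), by
      rw [(hq ⟨d, hdm⟩).2.2]; exact hd⟩

variable [IsDomain A]

/-- After inverting a nonzero element of `A`, an ideal of `A[x₁, …, x_N]` has a complement that is
spanned by monomials. -/
theorem exists_standard_monomials (J : Ideal (MvPolynomial (Fin N) A)) :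
    ∃ P : A, P ≠ 0 ∧ ∃ Δ : Set (Fin N →₀ ℕ),
      (∀ q : MvPolynomial (Fin N) A, ∃ (M : ℕ) (r : MvPolynomial (Fin N) A),
        (∀ d ∈ r.support, d ∈ Δ) ∧ C (P ^ M) * q - r ∈ J) ∧
      ∀ q ∈ J, (∀ d ∈ q.support, d ∈ Δ) → q = 0 := by
  classical
  let m : MonomialOrder (Fin N) := MonomialOrder.lex
  obtain ⟨T, hTJ, hT⟩ := exists_finset_leading m J
  -- Division by `T` requires inverting only its leading coefficients; the standard monomials `Δ`
  -- are those divisible by no leading monomial of `T`.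
  refine ⟨∏ p ∈ T, m.leadingCoeff p, Finset.prod_ne_zero_iff.2 fun p hp =>
    leadingCoeff_ne_zero_iff.2 (hTJ p hp).2, {d | ∀ p ∈ T, ¬ m.degree p ≤ d}, ?_, ?_⟩
  swap
  · intro q hq hqΔ
    by_contra hq0
    obtain ⟨p, hp, hpq⟩ := hT q hq hq0
    exact hqΔ _ (degree_mem_support hq0) p hp hpq
  set P := ∏ p ∈ T, m.leadingCoeff p
  set Δ : Set (Fin N →₀ ℕ) := {d | ∀ p ∈ T, ¬ m.degree p ≤ d}
  let good : MvPolynomial (Fin N) A → Prop := fun q => ∃ (M : ℕ) (r : MvPolynomial (Fin N) A),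
        (∀ d ∈ r.support, d ∈ Δ) ∧ C (P ^ M) * q - r ∈ J
  have hup : ∀ q M r, (∀ d ∈ r.support, d ∈ Δ) → C (P ^ M) * q - r ∈ J → ∀ M', M ≤ M' →
      ∃ r', (∀ d ∈ r'.support, d ∈ Δ) ∧ C (P ^ M') * q - r' ∈ J := by
    intro q M r hr hq M' hM
    refine ⟨C (P ^ (M' - M)) * r, fun d hd => hr d ?_, ?_⟩
    · rw [mem_support_iff, coeff_C_mul] at hd
      exact mem_support_iff.2 (right_ne_zero_of_mul hd)
    · have : C (P ^ M') * q - C (P ^ (M' - M)) * r = C (P ^ (M' - M)) * (C (P ^ M) * q - r) := by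
        rw [mul_sub, ← mul_assoc, ← C_mul, ← pow_add, Nat.sub_add_cancel hM]
      rw [this]
      exact J.mul_mem_left _ hq
  have hadd : ∀ q q', good q → good q' → good (q + q') := by
    rintro q q' ⟨M, r, hr, hq⟩ ⟨M', r', hr', hq'⟩
    obtain ⟨t, ht, hqt⟩ := hup q M r hr hq (max M M') (le_max_left _ _)
    obtain ⟨t', ht', hqt'⟩ := hup q' M' r' hr' hq' (max M M') (le_max_right _ _)
    refine ⟨max M M', t + t', fun d hd => ?_, ?_⟩
    · rcases Finset.mem_union.1 (support_add hd) with h | h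
      exacts [ht d h, ht' d h]
    · have : C (P ^ max M M') * (q + q') - (t + t') =
        (C (P ^ max M M') * q - t) + (C (P ^ max M M') * q' - t') := by ring
      rw [this]
      exact J.add_mem hqt hqt'
  have hzero : good 0 := ⟨0, 0, by simp, by simp⟩
  have hsupp : ∀ q, (∀ d ∈ q.support, ∀ c, good (monomial d c)) → good q := by
    intro q hq
    rw [q.as_sum]
    exact Finset.sum_induction _ good hadd hzero fun d hd => hq d hd _
  have hmon : ∀ d : Fin N →₀ ℕ, ∀ c, good (monomial d c) := by
    intro d
    induction hd : m.toSyn d using WellFoundedLT.induction generalizing d with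
    | _ y ih =>
    subst hd
    intro c
    by_cases hdΔ : d ∈ Δ
    · refine ⟨0, monomial d c, fun d' hd' => ?_, by simp⟩
      rw [Finset.mem_singleton.1 (support_monomial_subset hd')]
      exact hdΔ
    · simp only [Δ, Set.mem_ofPred_eq, not_forall, not_not] at hdΔ
      obtain ⟨p, hp, hpd⟩ := hdΔ
      -- Cross-multiplication cancels the monomial `d`, so that all monomials of `low` are strictly
      -- smaller.
      set low := C (m.leadingCoeff p) * monomial d c - monomial (d - m.degree p) c * p with hlow
      have hgood : good low := by
        refine hsupp low fun d' hd' c' => ih (m.toSyn d') ?_ d' rfl c'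
        have hle : m.toSyn d' ≤ m.toSyn d := by
          refine (m.le_degree hd').trans ((m.degree_sub_le).trans (sup_le ?_ ?_))
          · rw [C_mul_monomial]
            exact m.degree_monomial_le _
          · refine (m.degree_mul_le).trans ?_
            rw [map_add]
            refine (add_le_add_left (m.degree_monomial_le _) _).trans ?_
            rw [← map_add, tsub_add_cancel_of_le hpd]
        refine lt_of_le_of_ne hle fun heq => ?_
        have hdd : d' = d := m.toSyn.injective heq
        subst hdd
        refine mem_support_iff.1 hd' ?_
        have h1 : coeff d' (monomial (d' - m.degree p) c * p) = c * m.leadingCoeff p := by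
          have := coeff_monomial_mul (m.degree p) (d' - m.degree p) c p
          rwa [tsub_add_cancel_of_le hpd] at this
        rw [hlow, coeff_sub, h1, coeff_C_mul, coeff_monomial, if_pos rfl]
        ring
      obtain ⟨M, r, hr, hM⟩ := hgood
      refine ⟨M + 1, C (∏ p' ∈ T.erase p, m.leadingCoeff p') * r, fun d' hd' => hr d' ?_, ?_⟩
      · rw [mem_support_iff, coeff_C_mul] at hd'
        exact mem_support_iff.2 (right_ne_zero_of_mul hd')
      · have hP : P = m.leadingCoeff p * ∏ p' ∈ T.erase p, m.leadingCoeff p' :=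
          (Finset.mul_prod_erase T _ hp).symm
        set Q := ∏ p' ∈ T.erase p, m.leadingCoeff p'
        have : C (P ^ (M + 1)) * monomial d c - C Q * r =
            C Q * (C (P ^ M) * low - r) +
              (C Q * C (P ^ M) * monomial (d - m.degree p) c) * p := by
          rw [hlow, pow_succ]
          nth_rewrite 2 [hP]
          simp only [C_mul]
          ring
        rw [this]
        exact J.add_mem (J.mul_mem_left _ hM) (J.mul_mem_left _ (hTJ p hp).1)
  exact fun q => hsupp q fun d _ c => hmon d c

/-- **Generic flatness**: after inverting a nonzero element of the domain `A`, the quotient of an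
`A`-algebra of finite type by an ideal `I` satisfies `I ∩ 𝔪 B = 𝔪 I` for all ideals `𝔪` of `A`. -/
theorem exists_generic_flatness {B : Type*} [CommRing B]
    (π : MvPolynomial (Fin N) A →+* B) (hπ : Function.Surjective π) (I : Ideal B) :
    ∃ P : A, P ≠ 0 ∧ ∀ (𝔪 : Ideal A), ∀ e ∈ I, e ∈ 𝔪.map (π.comp C) →
      ∃ M : ℕ, π (C (P ^ M)) * e ∈ 𝔪.map (π.comp C) * I := by
  classical
  obtain ⟨P, hP, Δ, hΔ1, hΔ2⟩ := exists_standard_monomials (I.comap π)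
  refine ⟨P, hP, fun 𝔪 e heI he => ?_⟩
  rw [← Ideal.map_map, Ideal.mem_map_iff_of_surjective π hπ] at he
  obtain ⟨q, hq, rfl⟩ := he
  rw [mem_map_C_iff] at hq
  choose M r hr hMr using fun d : Fin N →₀ ℕ => hΔ1 (monomial d 1)
  let K := q.support.sup M
  have hK : ∀ d ∈ q.support, M d ≤ K := fun d hd => Finset.le_sup hd
  -- Each monomial of `q` is reduced separately, so the coefficients from `𝔪` stay as factors. The
  -- total remainder `R` is standard and lies in the ideal, hence vanishes, and `hRdiff` exhibits an
  -- element of `𝔪` times the ideal.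
  set R : MvPolynomial (Fin N) A := ∑ d ∈ q.support, C (coeff d q) * (C (P ^ (K - M d)) * r d)
  have hRdiff : C (P ^ K) * q - R = ∑ d ∈ q.support,
      C (coeff d q) * (C (P ^ (K - M d)) * (C (P ^ M d) * monomial d 1 - r d)) := by
    conv_lhs => rw [q.as_sum]
    rw [Finset.mul_sum, ← Finset.sum_sub_distrib]
    refine Finset.sum_congr rfl fun d hd => ?_
    have h1 : C (P ^ K) = C (σ := Fin N) (P ^ (K - M d)) * C (P ^ M d) := by
      rw [← C_mul, ← pow_add, Nat.sub_add_cancel (hK d hd)]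
    have h2 : monomial d (coeff d q) = C (coeff d q) * monomial d 1 := by
      rw [C_mul_monomial, mul_one]
    rw [h1, h2]
    ring
  have hR : R = 0 := by
    refine hΔ2 R ?_ fun d hd => ?_
    · have h1 : C (P ^ K) * q ∈ I.comap π := Ideal.mul_mem_left _ _ heI
      have h2 : C (P ^ K) * q - R ∈ I.comap π := by
        rw [hRdiff]
        exact Ideal.sum_mem _ fun d _ => Ideal.mul_mem_left _ _ (Ideal.mul_mem_left _ _ (hMr d))
      have := Ideal.sub_mem _ h1 h2
      rwa [sub_sub_cancel] at this
    · obtain ⟨d', -, hd'⟩ := Finset.mem_biUnion.1 (support_sum hd)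
      rw [mem_support_iff, coeff_C_mul, coeff_C_mul] at hd'
      exact hr d' d (mem_support_iff.2 (right_ne_zero_of_mul (right_ne_zero_of_mul hd')))
  refine ⟨K, ?_⟩
  rw [← map_mul]
  rw [hR, sub_zero] at hRdiff
  rw [hRdiff, map_sum]
  refine Ideal.sum_mem _ fun d _ => ?_
  rw [map_mul]
  refine Ideal.mul_mem_mul (Ideal.mem_map_of_mem (π.comp C) (hq d)) ?_
  rw [map_mul]
  exact Ideal.mul_mem_left _ _ (hMr d)

end GenericFreeness

end EffMember

namespace EffMember

/-! ### Weak regularity of tuples with indeterminate coefficients -/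

section RangeSpan

variable {R : Type*} [CommRing R] {f : ℕ → R} {j : ℕ}

lemma mem_span_image_range_iff {s : R} :
    s ∈ Ideal.span (f '' (Finset.range j : Set ℕ)) ↔
      ∃ c : ℕ → R, s = ∑ i ∈ Finset.range j, c i * f i := by
  rw [Ideal.span, Submodule.mem_span_image_finset_iff_exists_fun']
  exact exists_congr fun c => eq_comm

lemma exists_sum_of_mem_mul_span {𝔞 : Ideal R} {s : R}
    (hs : s ∈ 𝔞 * Ideal.span (f '' (Finset.range j : Set ℕ))) :
    ∃ c : ℕ → R, (∀ i, c i ∈ 𝔞) ∧ s = ∑ i ∈ Finset.range j, c i * f i := by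
  refine Submodule.mul_induction_on hs (fun a ha y hy => ?_) ?_
  · obtain ⟨c, rfl⟩ := mem_span_image_range_iff.1 hy
    exact ⟨fun i => a * c i, fun i => Ideal.mul_mem_right _ _ ha, by
      simp only [Finset.mul_sum, mul_assoc]⟩
  · rintro x y ⟨c, hc, rfl⟩ ⟨d, hd, rfl⟩
    exact ⟨c + d, fun i => add_mem (hc i) (hd i), by
      simp only [Pi.add_apply, add_mul, Finset.sum_add_distrib]⟩

end RangeSpan

section Universal

open MvPolynomial

variable {L : Type*} [CommRing L] {W : Type*}

/-- Ideals generated by variables are tested monomial by monomial, and multiplication by a new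
variable does not change the exponents of the earlier ones. -/
lemma wReg_variables (k : ℕ) (m₀ : W) :
    WReg k fun i => if hi : i < k then (X (⟨i, hi⟩, m₀) : MvPolynomial (Fin k × W) L) else 0 := by
  classical
  intro j hj s c hsc
  let T : Set (Fin k × W) := {p | (p.1 : ℕ) < j ∧ p.2 = m₀}
  have hmem : ∀ c : ℕ → MvPolynomial (Fin k × W) L, (∑ i ∈ Finset.range j,
      c i * if hi : i < k then (X (⟨i, hi⟩, m₀) : MvPolynomial (Fin k × W) L) else 0) ∈
      Ideal.span (X '' T) := by
    intro c
    refine Ideal.sum_mem _ fun i hi => Ideal.mul_mem_left _ _ ?_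
    have hij := Finset.mem_range.1 hi
    rw [dif_pos (hij.trans hj)]
    exact Ideal.subset_span ⟨_, ⟨hij, rfl⟩, rfl⟩
  have h1 := hmem c
  rw [← hsc] at h1
  simp only [dif_pos hj] at h1
  rw [mem_ideal_span_X_image] at h1
  have h2 : s ∈ Ideal.span (X '' T : Set (MvPolynomial (Fin k × W) L)) := by
    rw [mem_ideal_span_X_image]
    intro d hd
    obtain ⟨p, hp, hpd⟩ := h1 (d + Finsupp.single (⟨j, hj⟩, m₀) 1) (by
      rw [mem_support_iff, coeff_mul_X]
      exact mem_support_iff.1 hd)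
    refine ⟨p, hp, ?_⟩
    have hne : ((⟨j, hj⟩, m₀) : Fin k × W) ≠ p := by
      rintro rfl
      exact lt_irrefl _ hp.1
    rwa [Finsupp.add_apply, Finsupp.single_eq_of_ne' hne, add_zero] at hpd
  have h3 : (X '' T : Set (MvPolynomial (Fin k × W) L)) ⊆ (fun i : ℕ =>
      if hi : i < k then (X (⟨i, hi⟩, m₀) : MvPolynomial (Fin k × W) L) else 0) ''
        (Finset.range j : Set ℕ) := by
    rintro _ ⟨⟨⟨i, hi⟩, m⟩, ⟨hij, rfl⟩, rfl⟩
    exact ⟨i, by simpa using hij, by simp [hi]⟩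
  exact mem_span_image_range_iff.1 (Ideal.span_mono h3 h2)

variable [Fintype W]

/-- The universal linear combinations of the elements `x m` of `L`. -/
def univFamily (k : ℕ) (x : W → L) (i : ℕ) : MvPolynomial (Fin k × W) L :=
  if hi : i < k then ∑ m, X (⟨i, hi⟩, m) * C (x m) else 0

/-- The universal linear combinations form a weakly regular sequence. -/
theorem wReg_univFamily (k : ℕ) (x : W → L) (m₀ : W) {y : L} (hy : y * x m₀ = 1) :
    WReg k (univFamily k x) := by
  classical
  -- Because `x m₀` is a unit, the universal combinations can be traded for the variables `X (i,
  -- m₀)`: `Ψ` turns each combination into a unit multiple of its variable, and `Θ` undoes `Ψ`.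
  let Θ : MvPolynomial (Fin k × W) L →ₐ[L] MvPolynomial (Fin k × W) L := aeval fun p =>
    if p.2 = m₀ then C y * univFamily k x p.1 else X p
  let Ψ : MvPolynomial (Fin k × W) L →ₐ[L] MvPolynomial (Fin k × W) L := aeval fun p =>
    if p.2 = m₀ then X p - C y * ∑ m ∈ Finset.univ.erase m₀, X (p.1, m) * C (x m) else X p
  have hC : C y * C (x m₀) = (1 : MvPolynomial (Fin k × W) L) := by
    rw [← C_mul, hy, C_1]
  have hF : ∀ i (hi : i < k), univFamily k x i = X (⟨i, hi⟩, m₀) * C (x m₀) +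
      ∑ m ∈ Finset.univ.erase m₀, X (⟨i, hi⟩, m) * C (x m) := by
    intro i hi
    rw [univFamily, dif_pos hi]
    exact (Fintype.sum_eq_add_sum_compl m₀ _).trans (by rw [Finset.compl_singleton])
  have hsum : ∀ (Φ : MvPolynomial (Fin k × W) L →ₐ[L] MvPolynomial (Fin k × W) L)
      (hΦ : ∀ p : Fin k × W, p.2 ≠ m₀ → Φ (X p) = X p) (i : Fin k),
      Φ (∑ m ∈ Finset.univ.erase m₀, X (i, m) * C (x m)) =
        ∑ m ∈ Finset.univ.erase m₀, X (i, m) * C (x m) := by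
    intro Φ hΦ i
    rw [map_sum]
    refine Finset.sum_congr rfl fun m hm => ?_
    rw [map_mul, hΦ _ (Finset.ne_of_mem_erase hm)]
    congr 1
    exact Φ.commutes (x m)
  have hΘC : ∀ l, Θ (C l) = C l := fun l => Θ.commutes l
  have hΨC : ∀ l, Ψ (C l) = C l := fun l => Ψ.commutes l
  have hΘX : ∀ p : Fin k × W, p.2 ≠ m₀ → Θ (X p) = X p := fun p hp => by simp [Θ, hp]
  have hΨX : ∀ p : Fin k × W, p.2 ≠ m₀ → Ψ (X p) = X p := fun p hp => by simp [Ψ, hp]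
  have hΘ0 : ∀ i : Fin k, Θ (X (i, m₀)) = C y * univFamily k x i := fun i => by simp [Θ]
  have hΨ0 : ∀ i : Fin k, Ψ (X (i, m₀)) =
      X (i, m₀) - C y * ∑ m ∈ Finset.univ.erase m₀, X (i, m) * C (x m) := fun i => by simp [Ψ]
  have hΨF : ∀ i (hi : i < k), Ψ (univFamily k x i) = X (⟨i, hi⟩, m₀) * C (x m₀) := by
    intro i hi
    rw [hF i hi, map_add, map_mul, hΨ0, hΨC, hsum Ψ hΨX]
    linear_combination (- ∑ m ∈ Finset.univ.erase m₀, X (⟨i, hi⟩, m) * C (x m)) * hC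
  have hΘΨ : ∀ s, Θ (Ψ s) = s := by
    intro s
    have : Θ.comp Ψ = AlgHom.id L _ := by
      refine MvPolynomial.algHom_ext fun p => ?_
      rw [AlgHom.comp_apply, AlgHom.id_apply]
      by_cases hp : p.2 = m₀
      · obtain ⟨i, m⟩ := p
        obtain rfl : m = m₀ := hp
        rw [hΨ0, map_sub, map_mul, hΘ0, hΘC, hsum Θ hΘX, hF i i.2]
        linear_combination (X (i, m)) * hC
      · rw [hΨX p hp, hΘX p hp]
    exact DFunLike.congr_fun this s
  intro j hj s c hsc
  have h1 := congrArg Ψ hsc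
  rw [map_mul, hΨF j hj, map_sum] at h1
  obtain ⟨d, hd⟩ := wReg_variables k m₀ j hj (Ψ s) (fun i => Ψ (c i)) (by
    simp only [dif_pos hj]
    have h2 : ∑ i ∈ Finset.range j, Ψ (c i * univFamily k x i) = (∑ i ∈ Finset.range j,
        Ψ (c i) * if hi : i < k then (X (⟨i, hi⟩, m₀) : MvPolynomial (Fin k × W) L) else 0) *
        C (x m₀) := by
      rw [Finset.sum_mul]
      refine Finset.sum_congr rfl fun i hi => ?_
      have hik := (Finset.mem_range.1 hi).trans hj
      rw [map_mul, hΨF i hik, dif_pos hik]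
      ring
    rw [h2] at h1
    have h3 := congrArg (· * C y) h1
    simp only [mul_assoc] at h3
    rwa [mul_comm (C (x m₀)) (C y), hC, mul_one, mul_one] at h3)
  refine ⟨fun i => Θ (d i) * C y, ?_⟩
  rw [← hΘΨ s, hd, map_sum]
  refine Finset.sum_congr rfl fun i hi => ?_
  have hik := (Finset.mem_range.1 hi).trans hj
  simp only [dif_pos hik]
  rw [map_mul, hΘ0, mul_assoc]

end Universal

/-! ### Specialization of the coefficients -/

section Specialization

open MvPolynomial

variable {L : Type*} [CommRing L] [Algebra ℂ L] {σ : Type*}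

/-- Presents the polynomials over `L` as an algebra of finite type over the coefficient domain
`MvPolynomial σ ℂ`, the setting of `exists_generic_flatness`. -/
lemma exists_surjection_of_finiteType [Algebra.FiniteType ℂ L] :
    ∃ (N : ℕ) (π : MvPolynomial (Fin N) (MvPolynomial σ ℂ) →+* MvPolynomial σ L),
      Function.Surjective π ∧ π.comp C = MvPolynomial.map (algebraMap ℂ L) := by
  obtain ⟨N, ρ, hρ⟩ := Algebra.FiniteType.iff_quotient_mvPolynomial''.1
    (inferInstance : Algebra.FiniteType ℂ L)
  let π : MvPolynomial (Fin N) (MvPolynomial σ ℂ) →+* MvPolynomial σ L :=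
    eval₂Hom (MvPolynomial.map (algebraMap ℂ L)) fun t => C (ρ (X t))
  have hπC : ∀ q, π (C q) = MvPolynomial.map (algebraMap ℂ L) q := fun q => eval₂Hom_C _ _ _
  refine ⟨N, π, fun b => ?_, RingHom.ext hπC⟩
  have hconst : ∀ q, C (ρ q) ∈ π.range := by
    intro q
    induction q using MvPolynomial.induction_on with
    | C a =>
      refine ⟨C (C a), ?_⟩
      rw [hπC, map_C]
      congr 1
      exact (ρ.commutes a).symm
    | add p q hp hq =>
      rw [map_add, C_add]
      exact add_mem hp hq
    | mul_X p t hp =>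
      rw [map_mul, C_mul]
      exact mul_mem hp ⟨X t, eval₂Hom_X' _ _ _⟩
  change b ∈ π.range
  induction b using MvPolynomial.induction_on with
  | C l =>
    obtain ⟨q, rfl⟩ := hρ l
    exact hconst q
  | add p q hp hq => exact add_mem hp hq
  | mul_X p t hp => exact mul_mem hp ⟨C (X t), by rw [hπC, map_X]⟩

/-- Modulo the extended ideal of the point `a`, every variable equals its value. Hence whatever
vanishes under specialization lies in that extended ideal. -/
lemma sub_C_eval_mem (a : σ → ℂ) (b : MvPolynomial σ L) :
    b - C (eval (fun p => algebraMap ℂ L (a p)) b) ∈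
      (RingHom.ker (eval a)).map (MvPolynomial.map (σ := σ) (algebraMap ℂ L)) := by
  induction b using MvPolynomial.induction_on with
  | C l => simp
  | add p q hp hq =>
    rw [map_add, C_add, add_sub_add_comm]
    exact add_mem hp hq
  | mul_X p t hp =>
    have h1 : (X t - C (algebraMap ℂ L (a t)) : MvPolynomial σ L) ∈
        (RingHom.ker (eval a)).map (MvPolynomial.map (σ := σ) (algebraMap ℂ L)) := by
      have : (X t - C (a t) : MvPolynomial σ ℂ) ∈ RingHom.ker (eval a) := by
        simp [RingHom.mem_ker]
      simpa using Ideal.mem_map_of_mem (MvPolynomial.map (σ := σ) (algebraMap ℂ L)) this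
    set ev := eval (fun p => algebraMap ℂ L (a p)) p with hev
    have h2 : p * X t - C (eval (fun p => algebraMap ℂ L (a p)) (p * X t)) =
        (p - C ev) * X t + C ev * (X t - C (algebraMap ℂ L (a t))) := by
      rw [map_mul, eval_X, C_mul]
      ring
    rw [h2]
    exact add_mem (Ideal.mul_mem_right _ _ hp) (Ideal.mul_mem_left _ _ h1)

lemma eval_map_eq (a : σ → ℂ) (q : MvPolynomial σ ℂ) :
    eval (fun p => algebraMap ℂ L (a p)) (MvPolynomial.map (algebraMap ℂ L) q) =
      algebraMap ℂ L (eval a q) := by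
  rw [eval_map]
  exact (eval₂_comp (algebraMap ℂ L) a q).symm

/-- Weak regularity is inherited by generic specializations. -/
theorem exists_wReg_specialization [Algebra.FiniteType ℂ L] (k : ℕ) (F : ℕ → MvPolynomial σ L)
    (hF : WReg k F) : ∃ P : MvPolynomial σ ℂ, P ≠ 0 ∧ ∀ a : σ → ℂ, eval a P ≠ 0 →
      WReg k fun i => eval (fun p => algebraMap ℂ L (a p)) (F i) := by
  classical
  obtain ⟨N, π, hπ, hπC⟩ := exists_surjection_of_finiteType (L := L) (σ := σ)
  choose P hP0 hP using fun j : ℕ =>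
    exists_generic_flatness π hπ (Ideal.span (F '' (Finset.range (j + 1) : Set ℕ)))
  refine ⟨∏ j ∈ Finset.range k, P j, Finset.prod_ne_zero_iff.2 fun j _ => hP0 j,
    fun a ha j hj s c hsc => ?_⟩
  rw [map_prod, Finset.prod_ne_zero_iff] at ha
  have haj := ha j (Finset.mem_range.2 hj)
  set ev := eval (fun p => algebraMap ℂ L (a p)) with hev
  set 𝔪 := RingHom.ker (eval a) with h𝔪
  -- The relation at `a`, lifted with constant coefficients, lies in the ideal of the `F i` and
  -- vanishes at `a`. Flatness rewrites a multiple of it with coefficients `μ` vanishing at `a`;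
  -- subtracting gives a true universal relation, which regularity of `F` solves before specializing
  -- back.
  set e : MvPolynomial σ L := C s * F j - ∑ i ∈ Finset.range j, C (c i) * F i with he
  have hev𝔪 : ∀ b ∈ 𝔪.map (π.comp C), ev b = 0 := by
    intro b hb
    have : 𝔪.map (π.comp C) ≤ RingHom.ker ev := by
      rw [Ideal.map_le_iff_le_comap]
      intro q hq
      rw [Ideal.mem_comap, RingHom.mem_ker, hπC, hev, eval_map_eq, (RingHom.mem_ker).1 hq, map_zero]
    exact this hb
  have he0 : ev e = 0 := by
    simp only [he, map_sub, map_mul, map_sum, hev, eval_C]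
    rw [sub_eq_zero]
    exact hsc
  have hem : e ∈ 𝔪.map (π.comp C) := by
    have := sub_C_eval_mem a e
    rw [← hev, he0, C_0, sub_zero] at this
    rwa [hπC]
  have heI : e ∈ Ideal.span (F '' (Finset.range (j + 1) : Set ℕ)) := by
    refine Ideal.sub_mem _ (Ideal.mul_mem_left _ _ (Ideal.subset_span ⟨j, by simp, rfl⟩))
      (Ideal.sum_mem _ fun i hi => Ideal.mul_mem_left _ _ (Ideal.subset_span ⟨i, ?_, rfl⟩))
    have := Finset.mem_range.1 hi
    simp only [Finset.coe_range, Set.mem_Iio]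
    omega
  obtain ⟨M, hM⟩ := hP j 𝔪 e heI hem
  obtain ⟨μ, hμ, hμe⟩ := exists_sum_of_mem_mul_span hM
  set p := π (C (P j ^ M)) with hp
  have hevp : ev p = algebraMap ℂ L (eval a (P j) ^ M) := by
    rw [hp, ← RingHom.comp_apply π C, hπC, hev, eval_map_eq, map_pow]
  obtain ⟨d, hd⟩ := hF j hj (p * C s - μ j) (fun i => p * C (c i) + μ i) (by
    rw [Finset.sum_range_succ, he, mul_sub, Finset.mul_sum] at hμe
    simp only [add_mul, Finset.sum_add_distrib]
    have h1 : ∑ i ∈ Finset.range j, p * C (c i) * F i =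
        ∑ i ∈ Finset.range j, p * (C (c i) * F i) := Finset.sum_congr rfl fun i _ => mul_assoc _ _ _
    rw [h1]
    linear_combination hμe)
  refine ⟨fun i => algebraMap ℂ L ((eval a (P j) ^ M)⁻¹) * ev (d i), ?_⟩
  have h1 := congrArg ev hd
  rw [map_sub, map_mul, hev𝔪 _ (hμ j), sub_zero, hevp, map_sum] at h1
  have h2 : ev (C s) = s := eval_C s
  rw [h2] at h1
  have h3 : algebraMap ℂ L ((eval a (P j) ^ M)⁻¹) * algebraMap ℂ L (eval a (P j) ^ M) = 1 := by
    rw [← map_mul, inv_mul_cancel₀ (pow_ne_zero _ haj), map_one]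
  have h4 : s = algebraMap ℂ L ((eval a (P j) ^ M)⁻¹) *
      ∑ i ∈ Finset.range j, ev (d i * F i) := by
    rw [← h1, ← mul_assoc, h3, one_mul]
  rw [h4, Finset.mul_sum]
  exact Finset.sum_congr rfl fun i _ => by rw [map_mul, mul_assoc]

end Specialization

end EffMember

namespace EffMember

/-! ### Translation between lists and sequences -/

section Lists

variable {R : Type*} [CommRing R] {k : ℕ}

/-- Extension of a finite sequence by zero. -/
def extendZero (f : Fin k → R) (i : ℕ) : R := if hi : i < k then f ⟨i, hi⟩ else 0

lemma extendZero_of_lt (f : Fin k → R) {i : ℕ} (hi : i < k) : extendZero f i = f ⟨i, hi⟩ :=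
  dif_pos hi

lemma ofList_take_ofFn (f : Fin k → R) {j : ℕ} (hj : j ≤ k) :
    Ideal.ofList ((List.ofFn f).take j) =
      Ideal.span (extendZero f '' (Finset.range j : Set ℕ)) := by
  refine congrArg Ideal.span (Set.ext fun r => ?_)
  change r ∈ (List.ofFn f).take j ↔ _
  simp only [List.mem_take_iff_getElem, Set.mem_image, Finset.coe_range, Set.mem_Iio]
  constructor
  · rintro ⟨i, hi, rfl⟩
    have hi' : i < j := (lt_min_iff.1 hi).1
    exact ⟨i, hi', by rw [extendZero_of_lt f (hi'.trans_le hj), List.getElem_ofFn]⟩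
  · rintro ⟨i, hi, rfl⟩
    exact ⟨i, by simp; omega, by rw [extendZero_of_lt f (hi.trans_le hj), List.getElem_ofFn]⟩

lemma isWeaklyRegular_ofFn_iff (f : Fin k → R) :
    RingTheory.Sequence.IsWeaklyRegular R (List.ofFn f) ↔ WReg k (extendZero f) := by
  rw [RingTheory.Sequence.isWeaklyRegular_iff]
  simp only [List.length_ofFn, List.getElem_ofFn]
  refine forall_congr' fun j => forall_congr' fun hj => ?_
  rw [isSMulRegular_quotient_iff_mem_of_smul_mem, ofList_take_ofFn f hj.le]
  simp only [smul_eq_mul, Ideal.mul_top, mem_span_image_range_iff, extendZero_of_lt f hj]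
  constructor
  · intro h s c hsc
    exact h s ⟨c, by rw [mul_comm]; exact hsc⟩
  · rintro h s ⟨c, hsc⟩
    exact h s c (by rw [mul_comm]; exact hsc)

lemma isRegular_ofFn_iff (f : Fin k → R) :
    RingTheory.Sequence.IsRegular R (List.ofFn f) ↔ WReg k (extendZero f) ∧
      1 ∉ Ideal.span (extendZero f '' (Finset.range k : Set ℕ)) := by
  rw [RingTheory.Sequence.isRegular_iff, isWeaklyRegular_ofFn_iff]
  refine and_congr_right fun _ => ?_
  have h := ofList_take_ofFn f le_rfl
  rw [List.take_of_length_le (by simp)] at h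
  rw [h, smul_eq_mul, Ideal.mul_top, ne_comm, Ne, Ideal.eq_top_iff_one]

lemma span_extendZero (f : Fin k → R) :
    Ideal.span (extendZero f '' (Finset.range k : Set ℕ)) = Ideal.span (Set.range f) := by
  congr 1
  ext r
  simp only [Set.mem_image, Finset.coe_range, Set.mem_Iio, Set.mem_range]
  constructor
  · rintro ⟨i, hi, rfl⟩
    exact ⟨⟨i, hi⟩, (extendZero_of_lt f hi).symm⟩
  · rintro ⟨i, rfl⟩
    exact ⟨i, i.2, extendZero_of_lt f i.2⟩

end Lists

/-! ### Algebraic independence of regular sequences -/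

section AlgebraicIndependence

variable {R : Type*} [CommRing R]

open MvPolynomial

/-- Regularity modulo an ideal `𝔞`. -/
def RegMod (𝔞 : Ideal R) (k : ℕ) (f : ℕ → R) : Prop :=
  (∀ j < k, ∀ s, s * f j ∈ 𝔞 ⊔ Ideal.span (f '' (Finset.range j : Set ℕ)) →
    s ∈ 𝔞 ⊔ Ideal.span (f '' (Finset.range j : Set ℕ))) ∧
  1 ∉ 𝔞 ⊔ Ideal.span (f '' (Finset.range k : Set ℕ))

lemma RegMod.tail {𝔞 : Ideal R} {k : ℕ} {f : ℕ → R} (h : RegMod 𝔞 (k + 1) f) :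
    RegMod (𝔞 ⊔ Ideal.span {f 0}) k fun i => f (i + 1) := by
  have key : ∀ j, 𝔞 ⊔ Ideal.span {f 0} ⊔
      Ideal.span ((fun i => f (i + 1)) '' (Finset.range j : Set ℕ)) =
      𝔞 ⊔ Ideal.span (f '' (Finset.range (j + 1) : Set ℕ)) := by
    intro j
    rw [sup_assoc, ← Ideal.span_union]
    congr 2
    ext r
    simp only [Set.mem_union, Set.mem_singleton_iff, Set.mem_image, Finset.coe_range, Set.mem_Iio]
    constructor
    · rintro (rfl | ⟨i, hi, rfl⟩)
      exacts [⟨0, by omega, rfl⟩, ⟨i + 1, by omega, rfl⟩]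
    · rintro ⟨_ | i, hi, rfl⟩
      exacts [Or.inl rfl, Or.inr ⟨i, by omega, rfl⟩]
  refine ⟨fun j hj s hs => ?_, ?_⟩
  · rw [key] at hs ⊢
    exact h.1 (j + 1) (by omega) s hs
  · rw [key]
    exact h.2

/-- The members of a regular sequence satisfy no polynomial relation, not even modulo `𝔞`. -/
lemma RegMod.eq_zero_of_aeval_mem [Algebra ℂ R] {k : ℕ} {𝔞 : Ideal R} {f : ℕ → R}
    (h : RegMod 𝔞 k f) (Q : MvPolynomial (Fin k) ℂ)
    (hQ : aeval (fun i : Fin k => f i) Q ∈ 𝔞) : Q = 0 := by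
  induction k generalizing 𝔞 f with
  | zero =>
    obtain ⟨c, rfl⟩ := C_surjective (R := ℂ) (Fin 0) Q
    by_contra hc
    have hc0 : c ≠ 0 := fun h0 => hc (by rw [h0, C_0])
    refine h.2 (Ideal.mem_sup_left ?_)
    rw [aeval_C] at hQ
    have := 𝔞.mul_mem_left (algebraMap ℂ R c⁻¹) hQ
    rwa [← map_mul, inv_mul_cancel₀ hc0, map_one] at this
  | succ k ih =>
    let φ : MvPolynomial (Fin k) ℂ →+* R := (aeval fun i : Fin k => f (i + 1)).toRingHom
    -- A relation is read as a polynomial in the first variable. Its constant coefficient is a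
    -- relation of the tail modulo `f 0`, hence zero; regularity of `f 0` modulo `𝔞` then divides it
    -- out and lowers the degree.
    have hpoly : ∀ (N : ℕ) (p : Polynomial (MvPolynomial (Fin k) ℂ)), p.natDegree ≤ N →
        p.eval₂ φ (f 0) ∈ 𝔞 → p = 0 := by
      intro N
      induction N with
      | zero | succ N ihN =>
        intro p hp hmem
        have hdec : p.eval₂ φ (f 0) = p.divX.eval₂ φ (f 0) * f 0 + φ (p.coeff 0) := by
          conv_lhs => rw [← p.divX_mul_X_add]
          rw [Polynomial.eval₂_add, Polynomial.eval₂_mul, Polynomial.eval₂_X, Polynomial.eval₂_C]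
        have h0 : p.coeff 0 = 0 := by
          refine ih h.tail _ ?_
          have h1 : φ (p.coeff 0) = p.eval₂ φ (f 0) - p.divX.eval₂ φ (f 0) * f 0 := by
            rw [hdec]; ring
          change φ (p.coeff 0) ∈ _
          rw [h1]
          exact Ideal.sub_mem _ (Ideal.mem_sup_left hmem)
            (Ideal.mem_sup_right (Ideal.mul_mem_left _ _ (Ideal.mem_span_singleton_self _)))
        first
        | rw [Polynomial.eq_C_of_natDegree_le_zero hp, h0, Polynomial.C_0]
        | rw [hdec, h0, map_zero, add_zero] at hmem
          have h1 := h.1 0 (Nat.succ_pos k) (p.divX.eval₂ φ (f 0)) (Ideal.mem_sup_left hmem)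
          simp only [Finset.range_zero, Finset.coe_empty, Set.image_empty, Ideal.span_empty,
            sup_bot_eq] at h1
          have h2 := ihN p.divX (by rw [Polynomial.natDegree_divX_eq_natDegree_tsub_one]; omega) h1
          rw [← p.divX_mul_X_add, h2, h0]
          simp
    have hcomp : ∀ Q : MvPolynomial (Fin (k + 1)) ℂ, aeval (fun i : Fin (k + 1) => f i) Q =
        (finSuccEquiv ℂ k Q).eval₂ φ (f 0) := by
      intro Q
      induction Q using MvPolynomial.induction_on with
      | C a =>
        rw [aeval_C, finSuccEquiv_apply, eval₂Hom_C, RingHom.comp_apply, Polynomial.eval₂_C]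
        exact (AlgHom.commutes _ a).symm
      | add p q hp hq => rw [map_add, map_add, Polynomial.eval₂_add, hp, hq]
      | mul_X p i hp =>
        rw [map_mul, map_mul, Polynomial.eval₂_mul, hp, aeval_X]
        congr 1
        refine Fin.cases ?_ (fun i => ?_) i
        · rw [finSuccEquiv_X_zero, Polynomial.eval₂_X]; rfl
        · rw [finSuccEquiv_X_succ, Polynomial.eval₂_C]
          simp [φ]
    have := hpoly _ (finSuccEquiv ℂ k Q) le_rfl (hcomp Q ▸ hQ)
    exact (map_eq_zero_iff _ (finSuccEquiv ℂ k).injective).1 this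

end AlgebraicIndependence

end EffMember

namespace EffMember

/-! ### Transcendence degree and the length of a regular sequence -/

section TranscendenceDegree

variable {J : Type} [Fintype J]

lemma single_mem_adjoin_of_nonneg [DecidableEq J] (v : J → ℕ) :
    (AddMonoidAlgebra.single (fun j => (v j : ℤ)) 1 : AddMonoidAlgebra ℂ (J → ℤ)) ∈
      Algebra.adjoin ℂ (Set.range fun j : J =>
        (AddMonoidAlgebra.single (Pi.single j (1 : ℤ)) 1 : AddMonoidAlgebra ℂ (J → ℤ))) := by
  have h : (AddMonoidAlgebra.single (fun j => (v j : ℤ)) 1 : AddMonoidAlgebra ℂ (J → ℤ)) =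
      ∏ j, (AddMonoidAlgebra.single (Pi.single j (1 : ℤ)) 1 : AddMonoidAlgebra ℂ (J → ℤ)) ^ v j := by
    have h1 : ∀ T : Finset J,
        ∏ j ∈ T, (AddMonoidAlgebra.single (Pi.single j (1 : ℤ)) 1 :
          AddMonoidAlgebra ℂ (J → ℤ)) ^ v j =
        AddMonoidAlgebra.single (∑ j ∈ T, v j • Pi.single j (1 : ℤ)) 1 := by
      intro T
      induction T using Finset.induction_on with
      | empty => simp [AddMonoidAlgebra.one_def]
      | insert j T hj ih =>
        rw [Finset.prod_insert hj, Finset.sum_insert hj, ih, AddMonoidAlgebra.single_pow,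
          AddMonoidAlgebra.single_mul_single, one_pow, one_mul]
    rw [h1]
    congr 1
    ext i
    simp [Finset.sum_apply, Pi.single_apply]
  rw [h]
  exact Subalgebra.prod_mem _ fun j _ =>
    Subalgebra.pow_mem _ (Algebra.subset_adjoin (Set.mem_range_self j)) _

/-- The Laurent ring is algebraic over the subalgebra generated by the coordinate monomials, since
each monomial times a suitable one with nonnegative exponents lies in that subalgebra. This bounds
the transcendence degree. -/
lemma card_le_of_algebraicIndependent {k : ℕ} {g : Fin k → AddMonoidAlgebra ℂ (J → ℤ)}
    (hg : AlgebraicIndependent ℂ g) : k ≤ Fintype.card J := by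
  classical
  set s : Set (AddMonoidAlgebra ℂ (J → ℤ)) := Set.range fun j : J =>
    (AddMonoidAlgebra.single (Pi.single j (1 : ℤ)) 1 : AddMonoidAlgebra ℂ (J → ℤ)) with hs
  have hpos : ∀ v : J → ℕ, IsAlgebraic (Algebra.adjoin ℂ s)
      (AddMonoidAlgebra.single (fun j => (v j : ℤ)) 1 : AddMonoidAlgebra ℂ (J → ℤ)) := fun v =>
    isAlgebraic_algebraMap (⟨_, single_mem_adjoin_of_nonneg v⟩ : Algebra.adjoin ℂ s)
  have hsingle : ∀ v : J → ℤ, IsAlgebraic (Algebra.adjoin ℂ s)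
      (AddMonoidAlgebra.single v 1 : AddMonoidAlgebra ℂ (J → ℤ)) := by
    intro v
    refine IsAlgebraic.of_mul (y := AddMonoidAlgebra.single (fun j => ((v j).natAbs : ℤ)) 1) ?_
      (hpos _) ?_
    · refine mem_nonZeroDivisors_of_ne_zero fun h => ?_
      simpa using congrArg (fun q : AddMonoidAlgebra ℂ (J → ℤ) => q.coeff
        (fun j => ((v j).natAbs : ℤ))) h
    · rw [AddMonoidAlgebra.single_mul_single, one_mul]
      have : (fun j => ((v j).natAbs : ℤ)) + v = fun j => (((v j).natAbs + v j).toNat : ℤ) := by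
        ext j
        simp only [Pi.add_apply]
        omega
      rw [this]
      exact hpos _
  have halg : Algebra.IsAlgebraic (Algebra.adjoin ℂ s) (AddMonoidAlgebra ℂ (J → ℤ)) := by
    refine ⟨fun q => ?_⟩
    induction q using AddMonoidAlgebra.induction_linear with
    | zero => exact isAlgebraic_zero
    | add p q hp hq => exact hp.add hq
    | single v c =>
      have : (AddMonoidAlgebra.single v c : AddMonoidAlgebra ℂ (J → ℤ)) =
          algebraMap ℂ _ c * AddMonoidAlgebra.single v 1 := by
        rw [← Algebra.smul_def]; simp
      rw [this]
      exact IsAlgebraic.mul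
        (isAlgebraic_algebraMap (algebraMap ℂ (Algebra.adjoin ℂ s) c)) (hsingle v)
  have h1 := hg.cardinalMk_le_trdeg.trans
    ((Algebra.IsAlgebraic.trdeg_le_cardinalMk ℂ s).trans Cardinal.mk_range_le)
  simpa using h1

/-- A regular sequence of `k` Laurent polynomials with exponents in a linear space `V` has length
at most the dimension of `V`. -/
theorem length_le_finrank_of_regular {n k : ℕ} (V : Submodule ℝ (Fin n → ℝ)) (f : ℕ → Laurent n)
    (hf : ∀ i, f i ∈ suppOn {m | toReal m ∈ V}) (hreg : RegMod ⊥ k f) :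
    k ≤ Module.finrank ℝ V := by
  classical
  let coord : Fin n → Module.Dual ℝ V := fun i => (LinearMap.proj i).comp V.subtype
  -- A maximal independent set of coordinate functions on `V` separates its points and has at most
  -- `dim V` members. Keeping only these integer coordinates is therefore injective on the lattice
  -- points of `V`.
  obtain ⟨b, hb, hspan, hli⟩ := exists_linearIndependent ℝ (Set.range coord)
  have hfin : b.Finite := (Set.finite_range coord).subset hb
  have : Fintype b := hfin.fintype
  choose idx hidx using fun φ : b => hb φ.2
  let p : (Fin n → ℤ) →+ (b → ℤ) :=
    { toFun := fun m φ => m (idx φ), map_zero' := rfl, map_add' := fun _ _ => rfl }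
  have hp : Set.InjOn p {m | toReal m ∈ V} := by
    intro m hm m' hm' hmm
    let w : V := ⟨toReal m, hm⟩ - ⟨toReal m', hm'⟩
    have h1 : ∀ φ ∈ Submodule.span ℝ b, φ w = 0 := by
      intro φ hφ
      induction hφ using Submodule.span_induction with
      | mem φ hφ =>
        have hφ' : φ = coord (idx ⟨φ, hφ⟩) := (hidx ⟨φ, hφ⟩).symm
        rw [hφ']
        have := congrFun hmm ⟨φ, hφ⟩
        simp only [p, AddMonoidHom.coe_mk, ZeroHom.coe_mk] at this
        simp [coord, w, toReal, this]
      | zero => rfl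
      | add x y _ _ hx hy => rw [LinearMap.add_apply, hx, hy, add_zero]
      | smul c x _ hx => rw [LinearMap.smul_apply, hx, smul_zero]
    ext i
    have h2 := h1 (coord i) (hspan ▸ Submodule.subset_span ⟨i, rfl⟩)
    simp only [coord, w, LinearMap.comp_apply, Submodule.subtype_apply, LinearMap.proj_apply,
      Submodule.coe_sub, Pi.sub_apply, toReal] at h2
    exact_mod_cast sub_eq_zero.1 h2
  let S : Subalgebra ℂ (Laurent n) :=
    { carrier := suppOn {m | toReal m ∈ V}
      mul_mem' := fun {x y} hx hy => mul_mem_suppOn hx hy fun a ha c hc => by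
        have := V.add_mem ha hc
        have h2 : toReal (a + c) = toReal a + toReal c := by ext i; simp [toReal]
        change toReal (a + c) ∈ V
        rwa [h2]
      add_mem' := fun hx hy => Submodule.add_mem _ hx hy
      algebraMap_mem' := fun c => by
        refine mem_suppOn.2 fun m hm => ?_
        have : m = 0 := by
          by_contra h0
          exact hm (by simp [AddMonoidAlgebra.coe_algebraMap, h0])
        subst this
        have h2 : toReal (0 : Fin n → ℤ) = 0 := by ext i; simp [toReal]
        change toReal 0 ∈ V
        rw [h2]
        exact V.zero_mem }
  have halg : AlgebraicIndependent ℂ fun i : Fin k =>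
      AddMonoidAlgebra.mapDomainAlgHom ℂ ℂ p (f i) := by
    rw [algebraicIndependent_iff]
    intro Q hQ
    refine hreg.eq_zero_of_aeval_mem Q ?_
    rw [Ideal.mem_bot]
    have h1 : MvPolynomial.aeval (fun i : Fin k => f i) Q ∈ S := by
      clear hQ
      induction Q using MvPolynomial.induction_on with
      | C c => rw [MvPolynomial.aeval_C]; exact S.algebraMap_mem c
      | add q r hq hr => rw [map_add]; exact S.add_mem hq hr
      | mul_X q i hq => rw [map_mul, MvPolynomial.aeval_X]; exact S.mul_mem hq (hf i)
    have h2 : AddMonoidAlgebra.mapDomainAlgHom ℂ ℂ p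
        (MvPolynomial.aeval (fun i : Fin k => f i) Q) = 0 := by
      rw [← hQ, ← AlgHom.comp_apply, MvPolynomial.comp_aeval]
    have h3 := Finsupp.mapDomain_injOn (M := ℂ) _ hp (x₁ := (0 : (Fin n → ℤ) →₀ ℂ))
      (by simp) (x₂ := (MvPolynomial.aeval (fun i : Fin k => f i) Q).coeff) h1
      (by
        have := congrArg AddMonoidAlgebra.coeff h2
        rw [Finsupp.mapDomain_zero]
        exact this.symm)
    exact laurent_ext fun m => by rw [← h3]; rfl
  have h1 := card_le_of_algebraicIndependent halg
  have h2 := hli.fintype_card_le_finrank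
  rw [Subspace.dual_finrank_eq] at h2
  exact h1.trans h2

end TranscendenceDegree

end EffMember

/-! ### The cone over a lattice polytope -/

namespace EffMember

variable {n k : ℕ} {B : Set (Fin n → ℝ)}

lemma finite_latticePts {X : Set (Fin n → ℝ)} (hX : Bornology.IsBounded X) :
    (latticePts X).Finite := by
  obtain ⟨R, hR⟩ := hX.exists_norm_le
  refine (Set.finite_Icc (fun _ : Fin n => -⌈R⌉) (fun _ => ⌈R⌉)).subset fun m hm => ?_
  have h1 : ∀ i, |(m i : ℝ)| ≤ R := fun i => (norm_le_pi_norm (toReal m) i).trans (hR _ hm)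
  refine ⟨fun i => ?_, fun i => ?_⟩
  · have h2 : ((-m i : ℤ) : ℝ) ≤ R := by
      push_cast
      exact (neg_le_abs _).trans (h1 i)
    have h3 : -m i ≤ ⌈R⌉ := by exact_mod_cast h2.trans (Int.le_ceil R)
    change -⌈R⌉ ≤ m i
    omega
  · have h3 : ((m i : ℤ) : ℝ) ≤ ⌈R⌉ := ((le_abs_self _).trans (h1 i)).trans (Int.le_ceil R)
    exact_mod_cast h3

lemma IsLatticePolytope.isBounded (hB : IsLatticePolytope B) : Bornology.IsBounded B := by
  obtain ⟨S, -, rfl⟩ := hB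
  exact isBounded_convexHull.2 (S.finite_toSet.image _).isBounded

lemma IsLatticePolytope.convex (hB : IsLatticePolytope B) : Convex ℝ B := by
  obtain ⟨S, -, rfl⟩ := hB
  exact convex_convexHull ℝ _

/-- A lattice polytope is the convex hull of the finite set of its lattice points. -/
lemma IsLatticePolytope.exists_finset (hB : IsLatticePolytope B) :
    ∃ S : Finset (Fin n → ℤ), S.Nonempty ∧ (∀ b, b ∈ S ↔ toReal b ∈ B) ∧
      B = convexHull ℝ (toReal '' (S : Set (Fin n → ℤ))) := by
  have hfin := finite_latticePts hB.isBounded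
  have hconv := hB.convex
  obtain ⟨S₀, hS₀, hBS⟩ := hB
  have hmem : ∀ b, b ∈ hfin.toFinset ↔ toReal b ∈ B := fun b => hfin.mem_toFinset
  have hsub : S₀ ⊆ hfin.toFinset := fun b hb => (hmem b).2 (by
    rw [hBS]
    exact subset_convexHull ℝ _ ⟨b, hb, rfl⟩)
  refine ⟨hfin.toFinset, hS₀.mono hsub, hmem, subset_antisymm ?_ (convexHull_min ?_ hconv)⟩
  · conv_lhs => rw [hBS]
    exact convexHull_mono (Set.image_mono hsub)
  · rintro _ ⟨b, hb, rfl⟩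
    exact (hmem b).1 hb

/-- The embedding of the lattice at height zero. -/
def atZero (n : ℕ) : (Fin n → ℤ) →+ (Fin n → ℝ) × ℝ where
  toFun m := (toReal m, 0)
  map_zero' := by ext <;> simp [toReal]
  map_add' a b := by ext <;> simp [toReal]

/-- The embedding of the lattice at height one. -/
def atOne (n : ℕ) (b : Fin n → ℤ) : (Fin n → ℝ) × ℝ := atZero n b + (0, 1)

lemma atZero_add (m : Fin n → ℤ) (x : Fin n → ℝ) (s : ℝ) :
    atZero n m + (x, s) = (toReal m + x, s) := by simp [atZero]

lemma atOne_eq (b : Fin n → ℤ) : atOne n b = (toReal b, 1) := by simp [atOne, atZero]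

variable {S : Finset (Fin n → ℤ)}

/-- The cone over a polytope. -/
lemma mem_coneOf_atOne (hS : S.Nonempty) (x : Fin n → ℝ) (s : ℝ) :
    (x, s) ∈ coneOf (atOne n) S ↔
      0 ≤ s ∧ x ∈ s • convexHull ℝ (toReal '' (S : Set (Fin n → ℤ))) := by
  constructor
  · rintro ⟨c, hc, h⟩
    have hx : x = ∑ b ∈ S, c b • toReal b := by
      simpa [atOne_eq, Prod.fst_sum] using congrArg Prod.fst h
    have hs : s = ∑ b ∈ S, c b := by
      simpa [atOne_eq, Prod.snd_sum] using congrArg Prod.snd h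
    have hs0 : 0 ≤ s := hs ▸ Finset.sum_nonneg fun b _ => hc b
    refine ⟨hs0, ?_⟩
    rcases hs0.eq_or_lt with h0 | h0
    · have hc0 := (Finset.sum_eq_zero_iff_of_nonneg fun b _ => hc b).1 (hs.symm.trans h0.symm)
      obtain ⟨b, hb⟩ := hS
      refine ⟨toReal b, subset_convexHull ℝ _ ⟨b, hb, rfl⟩, ?_⟩
      rw [hx, ← h0, Finset.sum_eq_zero fun b hb => by rw [hc0 b hb, zero_smul]]
      exact zero_smul _ _
    · rw [Set.mem_smul_set_iff_inv_smul_mem₀ h0.ne', hx, Finset.smul_sum]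
      simp only [smul_smul]
      refine (convex_convexHull ℝ _).sum_mem (fun b _ => mul_nonneg (inv_nonneg.2 hs0) (hc b)) ?_
        fun b hb => subset_convexHull ℝ _ ⟨b, hb, rfl⟩
      rw [← Finset.mul_sum, ← hs, inv_mul_cancel₀ h0.ne']
  · rintro ⟨hs, y, hy, rfl⟩
    have h1 : convexHull ℝ (toReal '' (S : Set (Fin n → ℤ))) ⊆
        {y | (y, (1 : ℝ)) ∈ coneOf (atOne n) S} := by
      refine convexHull_min ?_ ?_
      · rintro _ ⟨b, hb, rfl⟩
        have := gen_mem_coneOf (h := atOne n) hb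
        rwa [atOne_eq] at this
      · intro y hy z hz a b ha hb hab
        have := add_mem_coneOf (smul_mem_coneOf hy ha) (smul_mem_coneOf hz hb)
        simpa [hab] using this
    simpa using smul_mem_coneOf (h1 hy) hs

lemma mem_coneSupp_atOne (hS : S.Nonempty) {x : Fin n → ℝ} {s : ℝ} {m : Fin n → ℤ} :
    m ∈ coneSupp (atZero n) (0, 1) S (x, s) ↔
      0 ≤ s ∧ toReal m + x ∈ s • convexHull ℝ (toReal '' (S : Set (Fin n → ℤ))) := by
  rw [← mem_coneOf_atOne hS, ← atZero_add]
  rfl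

lemma finite_coneSupp (hS : S.Nonempty) (e : (Fin n → ℝ) × ℝ) :
    (coneSupp (atZero n) (0, 1) S e).Finite := by
  obtain ⟨x, s⟩ := e
  have hbd : Bornology.IsBounded (s • convexHull ℝ (toReal '' (S : Set (Fin n → ℤ))) + {-x}) :=
    ((isBounded_convexHull.2 (S.finite_toSet.image _).isBounded).smul₀ s).add
      Bornology.isBounded_singleton
  refine (finite_latticePts hbd).subset fun m hm => ?_
  exact ⟨_, ((mem_coneSupp_atOne hS).1 hm).2, _, rfl, by simp⟩

/-- The direction space of the polytope sits in the span at height zero, and properly so because the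
generators have height one. -/
lemma polyDim_lt_finrank (hS : S.Nonempty) :
    polyDim (convexHull ℝ (toReal '' (S : Set (Fin n → ℤ)))) + 1 ≤
      Module.finrank ℝ (Submodule.span ℝ (atOne n '' S)) := by
  set U := vectorSpan ℝ (convexHull ℝ (toReal '' (S : Set (Fin n → ℤ)))) with hU
  have hU' : U = vectorSpan ℝ (toReal '' (S : Set (Fin n → ℤ))) := by
    rw [hU, ← direction_affineSpan, affineSpan_convexHull, direction_affineSpan]
  have h1 : U.map (LinearMap.inl ℝ (Fin n → ℝ) ℝ) < Submodule.span ℝ (atOne n '' S) := by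
    obtain ⟨b₀, hb₀⟩ := hS
    refine lt_of_le_of_ne ?_ fun heq => ?_
    · rw [hU', vectorSpan, Submodule.map_span, Submodule.span_le]
      rintro _ ⟨_, ⟨_, ⟨b, hb, rfl⟩, _, ⟨b', hb', rfl⟩, rfl⟩, rfl⟩
      have : LinearMap.inl ℝ (Fin n → ℝ) ℝ (toReal b -ᵥ toReal b') = atOne n b - atOne n b' := by
        simp [atOne_eq]
      rw [this]
      exact Submodule.sub_mem _ (Submodule.subset_span ⟨b, hb, rfl⟩)
        (Submodule.subset_span ⟨b', hb', rfl⟩)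
    · have h2 : atOne n b₀ ∈ U.map (LinearMap.inl ℝ (Fin n → ℝ) ℝ) := by
        rw [heq]
        exact Submodule.subset_span ⟨b₀, hb₀, rfl⟩
      obtain ⟨y, -, hy⟩ := h2
      rw [atOne_eq] at hy
      simpa using congrArg Prod.snd hy
  have h3 := Submodule.finrank_lt_finrank_of_lt h1
  rw [← (Submodule.equivMapOfInjective _ LinearMap.inl_injective U).finrank_eq] at h3
  exact h3

/-- Nonempty faces of the cone over `B` are cones over faces of `B`. -/
lemma IsConeFace.exists_face (hS : S.Nonempty) {F : Finset (Fin n → ℤ)}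
    (hF : IsConeFace (atOne n) S F) (hne : F.Nonempty) :
    ∃ w, ∀ b, b ∈ F ↔
      b ∈ S ∧ toReal b ∈ face (convexHull ℝ (toReal '' (S : Set (Fin n → ℤ)))) w := by
  classical
  obtain ⟨v, hv, hF⟩ := hF
  refine ⟨fun i => v (Pi.single i 1, 0), fun b => ?_⟩
  have hlin : ∀ x, v (x, 1) = (fun i => v (Pi.single i 1, 0)) ⬝ᵥ x + v (0, 1) := by
    intro x
    have h1 : (x, (1 : ℝ)) = LinearMap.inl ℝ (Fin n → ℝ) ℝ x + (0, 1) := by simp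
    have h2 := LinearMap.pi_apply_eq_sum_univ (v ∘ₗ LinearMap.inl ℝ (Fin n → ℝ) ℝ) x
    rw [h1, map_add]
    congr 1
    rw [LinearMap.comp_apply] at h2
    rw [h2, dotProduct]
    refine Finset.sum_congr rfl fun i _ => ?_
    rw [smul_eq_mul, mul_comm, LinearMap.comp_apply, LinearMap.inl_apply]
    congr 3
    ext j
    simp [Pi.single_apply, eq_comm]
  have hpos : ∀ x ∈ convexHull ℝ (toReal '' (S : Set (Fin n → ℤ))), 0 ≤ v (x, 1) := fun x hx =>
    nonneg_of_mem_coneOf ((mem_coneOf_atOne hS x 1).2 ⟨zero_le_one, by rwa [one_smul]⟩) v hv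
  have hmem : ∀ b ∈ S, toReal b ∈ convexHull ℝ (toReal '' (S : Set (Fin n → ℤ))) := fun b hb =>
    subset_convexHull ℝ _ ⟨b, hb, rfl⟩
  rw [hF, and_congr_right_iff, atOne_eq]
  refine fun hb => ⟨fun h0 => ⟨hmem b hb, fun x hx => ?_⟩, fun h => ?_⟩
  · have h1 := hpos x hx
    rw [hlin] at h1 h0
    linarith
  -- A point of `F` shows that the minimum of `v` on the slice at height one is exactly zero, so
  -- minimality forces `v` to vanish.
  · obtain ⟨b₀, hb₀⟩ := hne
    obtain ⟨hb₀S, h1⟩ := (hF b₀).1 hb₀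
    have h2 := h.2 _ (hmem b₀ hb₀S)
    have h3 := hpos _ (hmem b hb)
    rw [atOne_eq] at h1
    rw [hlin] at h1 h3 ⊢
    linarith

lemma face_nonempty (hS : S.Nonempty) (w : Fin n → ℝ) :
    ∃ b ∈ S, toReal b ∈ face (convexHull ℝ (toReal '' (S : Set (Fin n → ℤ)))) w := by
  obtain ⟨b, hb, hmin⟩ := S.exists_min_image (fun b => w ⬝ᵥ toReal b) hS
  refine ⟨b, hb, subset_convexHull ℝ _ ⟨b, hb, rfl⟩, fun x hx => ?_⟩
  have h1 : convexHull ℝ (toReal '' (S : Set (Fin n → ℤ))) ⊆ {x | w ⬝ᵥ toReal b ≤ w ⬝ᵥ x} := by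
    refine convexHull_min ?_ (convex_halfSpace_ge
      ⟨fun x y => dotProduct_add _ _ _, fun c x => dotProduct_smul _ _ _⟩ _)
    rintro _ ⟨b', hb', rfl⟩
    exact hmin b' hb'
  exact h1 hx

lemma restrict_eq_filt {F : Finset (Fin n → ℤ)} {X : Set (Fin n → ℝ)}
    (hF : ∀ b, b ∈ F ↔ b ∈ S ∧ toReal b ∈ X) {f : Laurent n}
    (hf : f ∈ suppOn (S : Set (Fin n → ℤ))) : restrict f X = filt (· ∈ F) f := by
  classical
  change filt (fun m => toReal m ∈ X) f = _
  refine laurent_ext fun m => ?_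
  rw [coeff_filt, coeff_filt]
  by_cases hm : f.coeff m = 0
  · simp [hm]
  · simp only [hF, show m ∈ S from mem_suppOn.1 hf m hm, true_and]

lemma extendZero_restrict_eq_filt {F : Finset (Fin n → ℤ)} {X : Set (Fin n → ℝ)}
    (hF : ∀ b, b ∈ F ↔ b ∈ S ∧ toReal b ∈ X) {f : Fin k → Laurent n}
    (hf : ∀ i, f i ∈ suppOn (S : Set (Fin n → ℤ))) :
    (extendZero fun i => restrict (f i) X) = fun i => filt (· ∈ F) (extendZero f i) := by
  funext i
  unfold extendZero
  split_ifs with hi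
  · exact restrict_eq_filt hF (hf _)
  · exact (filt_zero _).symm

lemma mem_suppOn_of_newtonPolytope (hmem : ∀ b, b ∈ S ↔ toReal b ∈ B) {f : Laurent n}
    (hf : newtonPolytope f = B) : f ∈ suppOn (S : Set (Fin n → ℤ)) :=
  mem_suppOn.2 fun m hm => (hmem m).2 (hf ▸ subset_convexHull ℝ _
    ⟨m, Finsupp.mem_support_iff.2 hm, rfl⟩)

lemma extendZero_mem {R : Type*} [CommRing R] [Algebra ℂ R] {N : Submodule ℂ R} {f : Fin k → R}
    (hf : ∀ i, f i ∈ N) (i : ℕ) : extendZero f i ∈ N := by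
  unfold extendZero
  split_ifs
  exacts [hf _, N.zero_mem]

lemma sum_range_extendZero {R : Type*} [CommRing R] (s : ℕ → R) (f : Fin k → R) :
    ∑ i ∈ Finset.range k, s i * extendZero f i = ∑ i : Fin k, s i * f i := by
  rw [Finset.sum_range]
  exact Finset.sum_congr rfl fun i _ => by rw [extendZero_of_lt f i.2]

/-- Ideal membership with the expected supports, from regularity on the faces. -/
lemma exists_sum_of_mem_span (hS : S.Nonempty)
    (hBS : B = convexHull ℝ (toReal '' (S : Set (Fin n → ℤ)))) (hkB : k ≤ polyDim B)
    {f : Fin k → Laurent n} (hf : ∀ i, f i ∈ suppOn (S : Set (Fin n → ℤ)))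
    (hreg : ∀ w, WReg k (extendZero fun i => restrict (f i) (face B w)))
    {g : Laurent n} (hg : g ∈ Ideal.span (Set.range f)) {t : ℝ} (ht : 0 ≤ t + 1)
    (hgt : ∀ m, g.coeff m ≠ 0 → toReal m ∈ (t + 1) • B) :
    ∃ s : Fin k → Laurent n, (∀ i m, (s i).coeff m ≠ 0 → 0 ≤ t ∧ toReal m ∈ t • B) ∧
      g = ∑ i, s i * f i := by
  have hE : Effective (atZero n) (0, 1) (extendZero f) k S := by
    refine effective_of_regular_faces (finite_coneSupp hS) (fun F hF _ hne => ?_) k le_rfl ?_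
    · obtain ⟨w, hw⟩ := hF.exists_face hS hne
      rw [← hBS] at hw
      have := hreg w
      rwa [extendZero_restrict_eq_filt hw hf] at this
    · have := polyDim_lt_finrank hS
      rw [← hBS] at this
      exact (Nat.succ_le_succ hkB).trans this
  have hself : ∀ i, filt (· ∈ S) (extendZero f i) = extendZero f i := fun i =>
    filt_eq_self (mem_suppOn.1 (extendZero_mem hf i))
  rw [← span_extendZero, mem_span_image_range_iff] at hg
  obtain ⟨c, hc⟩ := hg
  -- The shift `(0, t)` places the coefficients at height `t`. Only `t + 1` has to be nonnegative;
  -- for negative `t` the cone has no points at this height and the coefficients vanish.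
  obtain ⟨s, hs, hgs⟩ := hE (0, t) g c (by simpa only [hself] using hc)
    (mem_suppOn.2 fun m hm => by
      rw [Prod.mk_add_mk, mem_coneSupp_atOne hS, ← hBS]
      exact ⟨ht, by simpa using hgt m hm⟩)
  refine ⟨fun i => s i, fun i m hm => ?_, ?_⟩
  · have := mem_suppOn.1 (hs i) m hm
    rwa [mem_coneSupp_atOne hS, ← hBS, add_zero] at this
  · rw [← sum_range_extendZero, hgs]
    simp only [hself]

end EffMember

/-! ### Existence and properties of generic tuples -/

namespace EffMember

open MvPolynomial in
/-- Generic tuples are weakly regular on any given nonempty set of exponents. -/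
lemma exists_wReg_filt {n : ℕ} (k : ℕ) {B : Set (Fin n → ℝ)} {W : Finset (Fin n → ℤ)}
    (hW : W.Nonempty) (hWB : ∀ b ∈ W, toReal b ∈ B) :
    ∃ P : MvPolynomial (Fin k × latticePts B) ℂ, P ≠ 0 ∧ ∀ f : Fin k → Laurent n,
      eval (fun p => (f p.1).coeff (p.2 : Fin n → ℤ)) P ≠ 0 →
        WReg k fun i => filt (· ∈ W) (extendZero f i) := by
  classical
  obtain ⟨m₀, hm₀⟩ := hW
  -- The universal combinations of these monomials specialize to the restrictions to `W`, and
  -- monomials are units, as `wReg_univFamily` requires of one of them.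
  let x : W → Laurent n := fun m => AddMonoidAlgebra.single (m : Fin n → ℤ) 1
  have hx : (AddMonoidAlgebra.single (-m₀) 1 : Laurent n) * x ⟨m₀, hm₀⟩ = 1 := by
    simp [x, AddMonoidAlgebra.single_mul_single, AddMonoidAlgebra.one_def]
  obtain ⟨P, hP0, hP⟩ := exists_wReg_specialization k _ (wReg_univFamily k x ⟨m₀, hm₀⟩ hx)
  let φ : Fin k × W → Fin k × latticePts B := fun p => (p.1, ⟨p.2, hWB _ p.2.2⟩)
  have hφ : Function.Injective φ := by
    rintro ⟨i, b⟩ ⟨i', b'⟩ h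
    have h1 := congrArg Prod.fst h
    have h2 := congrArg (fun p => (p.2 : Fin n → ℤ)) h
    exact Prod.ext h1 (Subtype.ext h2)
  refine ⟨rename φ P, fun h => hP0 (rename_injective φ hφ (h.trans (map_zero _).symm)),
    fun f hf => ?_⟩
  rw [eval_rename] at hf
  have h1 := hP _ hf
  convert h1 using 2 with i
  unfold univFamily extendZero
  split_ifs with hi
  · refine laurent_ext fun m => ?_
    rw [coeff_filt]
    simp only [map_sum, map_mul, eval_X, eval_C, x, φ, Function.comp, ← Algebra.smul_def,
      AddMonoidAlgebra.coeff_sum, AddMonoidAlgebra.coeff_smul, AddMonoidAlgebra.coeff_single,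
      Finsupp.finsetSum_apply, Finsupp.smul_apply, Finsupp.single_apply, smul_eq_mul, mul_ite,
      mul_one, mul_zero]
    rw [Finset.sum_coe_sort W fun b => if b = m then (f ⟨i, hi⟩).coeff b else 0,
      Finset.sum_ite_eq']
    split_ifs <;> rfl
  · rw [filt_zero, map_zero]

variable {n k : ℕ} {B : Set (Fin n → ℝ)}

/-- Effective membership at `t = -1`: the exponent of `1` is the point of `0 • B`, while
coefficients at height `-1` have empty support, so membership would give `1 = 0`. -/
lemma one_notMem_span {S : Finset (Fin n → ℤ)} (hS : S.Nonempty)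
    (hBS : B = convexHull ℝ (toReal '' (S : Set (Fin n → ℤ)))) (hkB : k ≤ polyDim B)
    {f : Fin k → Laurent n} (hf : ∀ i, f i ∈ suppOn (S : Set (Fin n → ℤ)))
    (hreg : ∀ w, WReg k (extendZero fun i => restrict (f i) (face B w))) :
    1 ∉ Ideal.span (Set.range f) := by
  classical
  intro h1
  obtain ⟨s, hs, h⟩ := exists_sum_of_mem_span hS hBS hkB hf hreg h1 (t := -1) (by norm_num)
    fun m hm => by
      have hm0 : m = 0 := by
        by_contra hne
        exact hm (by rw [AddMonoidAlgebra.one_def, AddMonoidAlgebra.coeff_single,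
          Finsupp.single_eq_of_ne hne])
      obtain ⟨b, hb⟩ := hS
      refine ⟨toReal b, hBS ▸ subset_convexHull ℝ _ ⟨b, hb, rfl⟩, ?_⟩
      ext i
      simp [hm0, toReal]
  have hs0 : ∀ i, s i = 0 := fun i => laurent_ext fun m => by
    by_contra hne
    have := (hs i m hne).1
    norm_num at this
  simp only [hs0, zero_mul, Finset.sum_const_zero] at h
  exact one_ne_zero h

open MvPolynomial in
-- There are finitely many sets of lattice points of `B`, so the nonvanishing conditions for
-- regularity multiply to a single one. A further factor makes all coefficients nonzero, which fixes
-- the Newton polytopes.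
theorem zariskiGenerically_isGeneric (hB : IsLatticePolytope B) (hkB : k ≤ polyDim B) :
    ZariskiGenerically k B (IsGeneric B) := by
  classical
  obtain ⟨S, hS, hmem, hBS⟩ := hB.exists_finset
  have hP : ∀ W : Finset (Fin n → ℤ), ∃ P : MvPolynomial (Fin k × latticePts B) ℂ, P ≠ 0 ∧
      (W ⊆ S → W.Nonempty → ∀ f : Fin k → Laurent n,
        eval (fun p => (f p.1).coeff (p.2 : Fin n → ℤ)) P ≠ 0 →
          WReg k fun i => filt (· ∈ W) (extendZero f i)) := by
    intro W
    by_cases hW : W ⊆ S ∧ W.Nonempty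
    · obtain ⟨P, hP0, hP⟩ := exists_wReg_filt k hW.2 fun b hb => (hmem b).1 (hW.1 hb)
      exact ⟨P, hP0, fun _ _ => hP⟩
    · exact ⟨1, one_ne_zero, fun h h' => absurd ⟨h, h'⟩ hW⟩
  choose P hP0 hP using hP
  refine ⟨(∏ W ∈ S.powerset, P W) * ∏ i, ∏ b : S, X (i, ⟨b, (hmem b).1 b.2⟩), ?_, ?_⟩
  · exact mul_ne_zero (Finset.prod_ne_zero_iff.2 fun W _ => hP0 W)
      (Finset.prod_ne_zero_iff.2 fun i _ => Finset.prod_ne_zero_iff.2 fun b _ => X_ne_zero _)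
  · intro f hf hne
    simp only [map_mul, map_prod, eval_X, mul_ne_zero_iff, Finset.prod_ne_zero_iff] at hne
    obtain ⟨hne, hcoeff⟩ := hne
    have hfS : ∀ i, f i ∈ suppOn (S : Set (Fin n → ℤ)) := fun i =>
      mem_suppOn.2 fun m hm => (hmem m).2 (mem_suppOn.1 (hf i) m hm)
    have hreg : ∀ w, WReg k (extendZero fun i => restrict (f i) (face B w)) := by
      intro w
      obtain ⟨b, hb, hbw⟩ := face_nonempty hS w
      rw [← hBS] at hbw
      have hmemF : ∀ b, b ∈ S.filter (fun b => toReal b ∈ face B w) ↔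
          b ∈ S ∧ toReal b ∈ face B w := fun b => Finset.mem_filter
      rw [extendZero_restrict_eq_filt hmemF hfS]
      exact hP _ (Finset.filter_subset _ _) ⟨b, (hmemF b).2 ⟨hb, hbw⟩⟩ f
        (hne _ (Finset.mem_powerset.2 (Finset.filter_subset _ _)))
    refine ⟨fun i => ?_, ?_, fun w => (isWeaklyRegular_ofFn_iff _).2 (hreg w)⟩
    · have hsupp : (f i).coeff.support = S := by
        ext m
        rw [Finsupp.mem_support_iff]
        exact ⟨mem_suppOn.1 (hfS i) m,
          fun hm => hcoeff i (Finset.mem_univ _) ⟨m, hm⟩ (Finset.mem_univ _)⟩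
      rw [newtonPolytope, hsupp, ← hBS]
    · rw [isRegular_ofFn_iff, span_extendZero]
      refine ⟨?_, one_notMem_span hS hBS hkB hfS hreg⟩
      -- The zero functional cuts out the face `B` itself, so regularity of the tuple is a case of
      -- regularity on faces.
      have h0 := hreg 0
      have h1 : ∀ b, b ∈ S ↔ b ∈ S ∧ toReal b ∈ face B 0 := fun b => by
        simp [face, ← hmem]
      rw [extendZero_restrict_eq_filt h1 hfS] at h0
      have h2 : ∀ i, filt (· ∈ S) (extendZero f i) = extendZero f i := fun i =>
        filt_eq_self (mem_suppOn.1 (extendZero_mem hfS i))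
      simpa only [h2] using h0

lemma regMod_bot_iff {R : Type*} [CommRing R] {f : ℕ → R} :
    RegMod ⊥ k f ↔ WReg k f ∧ 1 ∉ Ideal.span (f '' (Finset.range k : Set ℕ)) := by
  simp only [RegMod, bot_sup_eq, mem_span_image_range_iff, forall_exists_index, WReg]

lemma IsGeneric.regMod {f : Fin k → Laurent n} (hf : IsGeneric B f) :
    RegMod ⊥ k (extendZero f) :=
  regMod_bot_iff.2 ((isRegular_ofFn_iff f).1 hf.regular)

lemma RegMod.mul_unit {R : Type*} [CommRing R] {f : ℕ → R} (hf : RegMod ⊥ k f) {x y : R}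
    (hxy : x * y = 1) : RegMod ⊥ k fun i => x * f i := by
  rw [regMod_bot_iff] at hf ⊢
  refine ⟨fun j hj s c h => ?_, fun h => hf.2 ?_⟩
  · obtain ⟨c', hc'⟩ := hf.1 j hj s c (by
      calc s * f j = y * (s * (x * f j)) := by linear_combination (-s * f j) * hxy
        _ = ∑ i ∈ Finset.range j, c i * f i := by
          rw [h, Finset.mul_sum]
          exact Finset.sum_congr rfl fun i _ => by linear_combination (c i * f i) * hxy)
    refine ⟨fun i => c' i * y, hc'.trans (Finset.sum_congr rfl fun i _ => ?_)⟩
    linear_combination (-(c' i * f i)) * hxy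
  · rw [mem_span_image_range_iff] at h ⊢
    obtain ⟨c, hc⟩ := h
    exact ⟨fun i => c i * x, hc.trans (Finset.sum_congr rfl fun i _ => by ring)⟩

/-- The length of a generic tuple is at most the dimension of the polytope. -/
lemma IsGeneric.le_polyDim (hB : IsLatticePolytope B) {f : Fin k → Laurent n}
    (hf : IsGeneric B f) : k ≤ polyDim B := by
  obtain ⟨S, ⟨b₀, hb₀⟩, hmem, -⟩ := hB.exists_finset
  have hfS : ∀ i, f i ∈ suppOn (S : Set (Fin n → ℤ)) := fun i =>
    mem_suppOn_of_newtonPolytope hmem (hf.newton i)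
  have hxy : (AddMonoidAlgebra.single (-b₀) 1 : Laurent n) * AddMonoidAlgebra.single b₀ 1 = 1 := by
    simp [AddMonoidAlgebra.single_mul_single, AddMonoidAlgebra.one_def]
  -- Multiplication by the unit with exponent `-b₀` translates the supports into the direction space
  -- of `B` and preserves regularity.
  refine length_le_finrank_of_regular (vectorSpan ℝ B) _ (fun i => ?_) (hf.regMod.mul_unit hxy)
  refine mul_mem_suppOn (X := {-b₀}) (Y := (S : Set (Fin n → ℤ))) (mem_suppOn.2 fun m hm => ?_)
    (extendZero_mem hfS i) ?_
  · by_contra hne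
    exact hm (by rw [AddMonoidAlgebra.coeff_single, Finsupp.single_eq_of_ne hne])
  · rintro _ rfl b hb
    have : toReal (-b₀ + b) = toReal b -ᵥ toReal b₀ := by
      ext i
      simp [toReal]
      ring
    change toReal (-b₀ + b) ∈ vectorSpan ℝ B
    rw [this]
    exact vsub_mem_vectorSpan ℝ ((hmem b).1 hb) ((hmem b₀).1 hb₀)

theorem IsGeneric.isFoundation (hB : IsLatticePolytope B) {f : Fin k → Laurent n}
    (hf : IsGeneric B f) {A : Set (Fin n → ℝ)} {t : ℝ} (ht : 0 ≤ t) (hA : A ⊆ (t + 1) • B) :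
    IsFoundation f A (fun _ => t • B) := by
  obtain ⟨S, hS, hmem, hBS⟩ := hB.exists_finset
  refine le_antisymm ?_ ?_
  · rintro g ⟨⟨c, -, rfl⟩, hg⟩
    exact ⟨Submodule.sum_mem _ fun i _ =>
      Ideal.mul_mem_left _ _ (Ideal.subset_span ⟨i, rfl⟩), hg⟩
  · rintro g ⟨hg, hgA⟩
    obtain ⟨s, hs, hgs⟩ := exists_sum_of_mem_span hS hBS (hf.le_polyDim hB)
      (fun i => mem_suppOn_of_newtonPolytope hmem (hf.newton i))
      (fun w => (isWeaklyRegular_ofFn_iff _).1 (hf.regular_face w)) hg (by linarith)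
      fun m hm => hA (mem_suppOn.1 hgA m hm)
    exact ⟨⟨s, fun i => mem_suppOn.2 fun m hm => (hs i m hm).2, hgs⟩, hgA⟩

lemma IsGeneric.linearIndependent {f : Fin k → Laurent n} (hf : IsGeneric B f) :
    LinearIndependent ℂ f := by
  have h1 : AlgebraicIndependent ℂ fun i : Fin k => extendZero f i := by
    rw [algebraicIndependent_iff]
    exact fun Q hQ => hf.regMod.eq_zero_of_aeval_mem Q (by rw [hQ]; exact Ideal.zero_mem _)
  have h2 : (fun i : Fin k => extendZero f i) = f := funext fun i => extendZero_of_lt f i.2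
  rw [h2] at h1
  exact h1.linearIndependent

/-- At `t = 0` the only possible exponent of a coefficient is `0`, so the ideal members supported in
`B` are the constant combinations of the `f i`, which are linearly independent because they are
algebraically independent. -/
theorem IsGeneric.finrank_V (hB : IsLatticePolytope B) {f : Fin k → Laurent n}
    (hf : IsGeneric B f) : Module.finrank ℂ (V f B) = k := by
  have hspan : V f B = Submodule.span ℂ (Set.range f) := by
    refine le_antisymm ?_ (Submodule.span_le.2 ?_)
    · rw [← hf.isFoundation hB le_rfl (t := 0) (by rw [zero_add, one_smul])]
      rintro g ⟨⟨s, hs, rfl⟩, -⟩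
      refine Submodule.sum_mem _ fun i _ => ?_
      have h1 : s i = algebraMap ℂ (Laurent n) ((s i).coeff 0) := by
        refine laurent_ext fun m => ?_
        change _ = (AddMonoidAlgebra.single 0 ((s i).coeff 0) : Laurent n).coeff m
        rw [AddMonoidAlgebra.coeff_single]
        by_cases hm : m = 0
        · rw [hm, Finsupp.single_eq_same]
        · rw [Finsupp.single_eq_of_ne hm]
          by_contra hne
          obtain ⟨y, -, hy⟩ := mem_suppOn.1 (hs i) m hne
          refine hm (funext fun j => ?_)
          have := congrFun hy j
          simp only [zero_smul, toReal, Pi.zero_apply] at this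
          exact_mod_cast this.symm
      rw [h1, ← Algebra.smul_def]
      exact Submodule.smul_mem _ _ (Submodule.subset_span ⟨i, rfl⟩)
    · rintro _ ⟨i, rfl⟩
      refine ⟨Ideal.subset_span ⟨i, rfl⟩, mem_suppOn.2 fun m hm => ?_⟩
      rw [← hf.newton i]
      exact subset_convexHull ℝ _ ⟨m, Finsupp.mem_support_iff.2 hm, rfl⟩
  rw [hspan, finrank_span_eq_card hf.linearIndependent, Fintype.card_fin]

end EffMember

end

theorem mainTheorem1 (n k : ℕ) (hk : 1 ≤ k) (hkn : k + 1 ≤ n)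
    (B : Set (Fin n → ℝ)) (hB : EffMember.IsLatticePolytope B)
    (hseg : ¬ EffMember.IsSegment B) :
    (k ≤ EffMember.polyDim B →
      EffMember.ZariskiGenerically k B (EffMember.IsGeneric B)) ∧
    ∀ f : Fin k → EffMember.Laurent n, EffMember.IsGeneric B f →
      (∀ (A : Set (Fin n → ℝ)) (t : ℝ), 0 ≤ t → A ⊆ (t + 1) • B →
        EffMember.IsFoundation f A (fun _ => t • B)) ∧
      Module.finrank ℂ (EffMember.V f B) = k :=
  ⟨EffMember.zariskiGenerically_isGeneric hB, fun _ hf =>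
    ⟨fun _ _ ht hA => hf.isFoundation hB ht hA, hf.finrank_V hB⟩⟩
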